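/- **Definitions.** A promise problem (YES, NO) is *NP-hard* if every language $L\in\mathsf{NP}$ has a polynomial-time computable map $f$ with $f(w)\in\mathrm{YES}$ for $w\in L$ and $f(w)\in\mathrm{NO}$ for $w\notin L$. Let $z>y\ge 1$ be integers and $\alpha\in\mathbb R$. An instance of $(\alpha,z,y)$-*Johnson Coverage* is a universe $U=[n]$, a nonempty collection $E\subseteq\binom{[n]}{z}$ and an integer $k\ge 1$. It is a YES instance if there are $S_1,\dots,S_k\in\binom{[n]}{y}$ such that every $T\in E$ contains some $S_i$. It is a NO instance if for all $S_1,\dots,S_k\in\binom{[n]}{y}$ at most $\alpha|E|$ of the sets $T\in E$ contain some $S_i$. $(\alpha,z,y)$-*Johnson Coverage\** is the special case of instances with $|E|=\omega(k\cdot|U|^{z-y-1})$; that it is NP-hard means: for every constant $B$, $(\alpha,z,y)$-Johnson Coverage is NP-hard on the instances with $|E|\ge B\cdot k\cdot|U|^{z-y-1}$. The hypothesis JCH\* states that for every $\varepsilon>0$ there is $z\ge 2$ such that $(1-\frac1e+\varepsilon,z,z-1)$-Johnson Coverage\* is NP-hard. *Continuous $k$-means in the $\ell_1$-metric is NP-hard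 to approximate within a factor $F$* means here: there is a constant $K$ such that, given a nonempty set $P\subseteq\{0,1\}^d$ of $n$ points with $d\le K\log(n+1)$, a number $k\ge1$ and a unit of length $r\ge 1$ (integers written in unary), it is NP-hard to distinguish between * *Completeness:* there are $c_1,\dots,c_k\in\mathbb R^d$ and $\sigma:P\to\{c_1,\dots,c_k\}$ with $\sum_{a\in P}\|a-\sigma(a)\|_1^2\le r^2 n$; * *Soundness:* for all $c_1,\dots,c_k\in\mathbb R^d$ and all $\sigma:P\to\{c_1,\dots,c_k\}$, $\sum_{a\in P}\|a-\sigma(a)\|_1^2\ge F\cdot r^2 n$. **Theorem.** (1) Let $z>y\ge1$ and suppose that $(\alpha,z,y)$-Johnson Coverage\* is NP-hard. Then for every $\varepsilon>0$, continuous $k$-means in the $\ell_1$-metric is NP-hard to approximate within the factor $$\alpha+(1-\alpha)\frac{(z-y+1)^2}{(z-y)^2}-\varepsilon .$$ (2) Assume JCH\*. Then for every $\varepsilon>0$, continuous $k$-means in the $\ell_1$-metric is NP-hard to approximate within the factor $1+\frac3e-\varepsilon$; in particular it is NP-hard to approximate within the factor $2.10$. -/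

import Mathlib

/-! ## Model of computation

Data are finite binary trees.  A program denotes a partial function on trees; every elementary
operation is charged the full size of the tree it is applied to, and every composite construct is
charged one extra step, so that the size of an output never exceeds the time spent on it.
This model and multitape Turing machines simulate each other with polynomial overhead. -/

/-- Finite binary trees. -/
inductive BTree where
  | nil : BTree
  | cons (a b : BTree) : BTree

namespace BTree

/-- The number of nodes. -/
def size : BTree → ℕ
  | nil => 1
  | cons a b => a.size + b.size + 1

/-- Left subtree (`nil` for `nil`). -/
def left : BTree → BTree
  | nil => nil
  | cons a _ => a

/-- Right subtree (`nil` for `nil`). -/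
def right : BTree → BTree
  | nil => nil
  | cons _ b => b

/-- A list of trees, as a tree. -/
def ofList : List BTree → BTree
  | [] => nil
  | a :: l => cons a (ofList l)

/-- A bit: `false` is `nil`, `true` is `cons nil nil`. -/
def ofBool : Bool → BTree
  | false => nil
  | true => cons nil nil

/-- A bit string, as a tree. -/
def ofBits (w : List Bool) : BTree := ofList (w.map ofBool)

/-- A natural number, in unary. -/
def ofNat (n : ℕ) : BTree := ofList (List.replicate n nil)

end BTree

/-- Programs on trees. -/
inductive TreeProg where
  /-- `x ↦ nil` -/
  | nil : TreeProg
  /-- `x ↦ x` -/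
  | id : TreeProg
  /-- left subtree -/
  | left : TreeProg
  /-- right subtree -/
  | right : TreeProg
  /-- `x ↦ cons (p x) (q x)` -/
  | pair (p q : TreeProg) : TreeProg
  /-- `x ↦ q (p x)` -/
  | seq (p q : TreeProg) : TreeProg
  /-- if `c x ≠ nil` then `p x` else `q x` -/
  | ite (c p q : TreeProg) : TreeProg
  /-- while `c x ≠ nil` do `x := p x`; return `x` -/
  | loop (c p : TreeProg) : TreeProg

/-- `p.Runs x y t`: on input `x` the program `p` halts with output `y` after exactly `t` steps. -/
inductive TreeProg.Runs : TreeProg → BTree → BTree → ℕ → Prop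
  | nil (x : BTree) : Runs TreeProg.nil x BTree.nil x.size
  | id (x : BTree) : Runs TreeProg.id x x x.size
  | left (x : BTree) : Runs TreeProg.left x x.left x.size
  | right (x : BTree) : Runs TreeProg.right x x.right x.size
  | pair {p q : TreeProg} {x a b : BTree} {s t : ℕ} (hp : Runs p x a s) (hq : Runs q x b t) :
      Runs (TreeProg.pair p q) x (BTree.cons a b) (s + t + 1)
  | seq {p q : TreeProg} {x a b : BTree} {s t : ℕ} (hp : Runs p x a s) (hq : Runs q a b t) :
      Runs (TreeProg.seq p q) x b (s + t + 1)
  | ite_true {c p q : TreeProg} {x a b : BTree} {s t : ℕ} (hc : Runs c x a s)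
      (ha : a ≠ BTree.nil) (hp : Runs p x b t) : Runs (TreeProg.ite c p q) x b (s + t + 1)
  | ite_false {c p q : TreeProg} {x b : BTree} {s t : ℕ} (hc : Runs c x BTree.nil s)
      (hq : Runs q x b t) : Runs (TreeProg.ite c p q) x b (s + t + 1)
  | loop_done {c p : TreeProg} {x : BTree} {s : ℕ} (hc : Runs c x BTree.nil s) :
      Runs (TreeProg.loop c p) x x (s + x.size + 1)
  | loop_step {c p : TreeProg} {x a x' y : BTree} {s t u : ℕ} (hc : Runs c x a s)
      (ha : a ≠ BTree.nil) (hp : Runs p x x' t) (hl : Runs (TreeProg.loop c p) x' y u) :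
      Runs (TreeProg.loop c p) x y (s + t + u + 1)

/-- `f` is computable in time polynomial in the size of the encoded input. -/
def PolyTime {X : Type} (enc : X → BTree) (f : X → BTree) : Prop :=
  ∃ (p : TreeProg) (T : Polynomial ℕ), ∀ x, ∃ t ≤ T.eval (enc x).size, p.Runs (enc x) (f x) t

/-- The class NP: languages with certificates of polynomial length that are checked by a
polynomial-time verifier (which accepts by any output other than `nil`). -/
def InNP (L : Set (List Bool)) : Prop :=
  ∃ (v : List Bool × List Bool → BTree) (q : Polynomial ℕ),
    PolyTime (fun wc => BTree.cons (BTree.ofBits wc.1) (BTree.ofBits wc.2)) v ∧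
    ∀ w, w ∈ L ↔ ∃ c : List Bool, c.length ≤ q.eval w.length ∧ v (w, c) ≠ BTree.nil

/-- A promise ("gap") problem: the task is to distinguish `yes` from `no`. -/
structure PromiseProblem where
  yes : Set BTree
  no : Set BTree

/-- NP-hardness of a promise problem, under polynomial-time many-one reductions. -/
def PromiseProblem.NPHard (A : PromiseProblem) : Prop :=
  ∀ L : Set (List Bool), InNP L → ∃ f : List Bool → BTree, PolyTime BTree.ofBits f ∧
    ∀ w, (w ∈ L → f w ∈ A.yes) ∧ (w ∉ L → f w ∈ A.no)

/-! ## Johnson Coverage -/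

/-- A universe of `n` elements, a collection `E` of subsets, and a parameter `k`. -/
structure JCInstance where
  n : ℕ
  E : Finset (Finset (Fin n))
  k : ℕ

namespace JCInstance

/-- A subset of the universe is written as its characteristic bit string. -/
def treeOfSet {n : ℕ} (S : Finset (Fin n)) : BTree :=
  BTree.ofBits (List.ofFn fun i => decide (i ∈ S))

/-- `x` encodes the instance: `n` and `k`, followed by the sets in `E`, each once, in any order. -/
def Encodes (I : JCInstance) (x : BTree) : Prop :=
  ∃ l : List (Finset (Fin I.n)), l.Nodup ∧ l.toFinset = I.E ∧
    x = BTree.cons (BTree.ofNat I.n) (BTree.cons (BTree.ofNat I.k)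
      (BTree.ofList (l.map treeOfSet)))

/-- `E` is a nonempty collection of `z`-sets, and `k` is positive. -/
def Valid (I : JCInstance) (z : ℕ) : Prop :=
  I.E.Nonempty ∧ (∀ T ∈ I.E, T.card = z) ∧ 1 ≤ I.k

/-- `|E| ≥ B · k · |U|^(z-y-1)`. -/
def Dense (I : JCInstance) (z y B : ℕ) : Prop :=
  B * (I.k * I.n ^ (z - y - 1)) ≤ I.E.card

/-- The members of `E` that contain `S`. -/
def cov (I : JCInstance) (S : Finset (Fin I.n)) : Finset (Finset (Fin I.n)) :=
  I.E.filter fun T => S ⊆ T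

/-- The members of `E` that contain one of `S₁, …, S_k`. -/
def covAll (I : JCInstance) (S : Fin I.k → Finset (Fin I.n)) : Finset (Finset (Fin I.n)) :=
  Finset.univ.biUnion fun i => I.cov (S i)

/-- Some `k` sets of size `y` cover all of `E`. -/
def Complete (I : JCInstance) (y : ℕ) : Prop :=
  ∃ S : Fin I.k → Finset (Fin I.n), (∀ i, (S i).card = y) ∧ I.covAll S = I.E

/-- Any `k` sets of size `y` cover at most an `α` fraction of `E`. -/
def Sound (I : JCInstance) (α : ℝ) (y : ℕ) : Prop :=
  ∀ S : Fin I.k → Finset (Fin I.n), (∀ i, (S i).card = y) →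
    ((I.covAll S).card : ℝ) ≤ α * I.E.card

end JCInstance

/-- `(α, z, y)`-Johnson Coverage, restricted to instances with `|E| ≥ B · k · |U|^(z-y-1)`. -/
def denseJohnsonCoverage (α : ℝ) (z y B : ℕ) : PromiseProblem where
  yes := {x | ∃ I : JCInstance, I.Encodes x ∧ I.Valid z ∧ I.Dense z y B ∧ I.Complete y}
  no := {x | ∃ I : JCInstance, I.Encodes x ∧ I.Valid z ∧ I.Dense z y B ∧ I.Sound α y}

/-- `(α, z, y)`-Johnson Coverage* is NP-hard: Johnson Coverage is NP-hard on instances with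
`|E| = ω(k · |U|^(z-y-1))`, that is, `|E|` may be required to exceed any constant multiple of
`k · |U|^(z-y-1)`. -/
def JohnsonCoverageStarNPHard (α : ℝ) (z y : ℕ) : Prop :=
  ∀ B : ℕ, (denseJohnsonCoverage α z y B).NPHard

/-- The Dense Johnson Coverage Hypothesis. -/
def JCHStar : Prop :=
  ∀ ε : ℝ, 0 < ε → ∃ z : ℕ, 2 ≤ z ∧
    JohnsonCoverageStarNPHard (1 - 1 / Real.exp 1 + ε) z (z - 1)

/-! ## Continuous `k`-means in the `ℓ₁`-metric -/

/-- A set `P` of points of `{0,1}^d`, the number `k` of centers, and a unit of length `r`. -/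
structure KMeansInstance where
  d : ℕ
  P : Finset (Fin d → Bool)
  k : ℕ
  r : ℕ

/-- The `ℓ₁`-distance on `ℝ^d`. -/
def l1Dist {d : ℕ} (a b : Fin d → ℝ) : ℝ := ∑ i, |a i - b i|

namespace KMeansInstance

/-- `x` encodes the instance: `d`, `k` and `r`, followed by the points of `P`, each once, in any
order. -/
def Encodes (I : KMeansInstance) (x : BTree) : Prop :=
  ∃ l : List (Fin I.d → Bool), l.Nodup ∧ l.toFinset = I.P ∧
    x = BTree.cons (BTree.ofNat I.d) (BTree.cons (BTree.ofNat I.k) (BTree.cons (BTree.ofNat I.r)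
      (BTree.ofList (l.map fun a => BTree.ofBits (List.ofFn a)))))

/-- There is at least one point, and `k` and `r` are positive. -/
def Valid (I : KMeansInstance) : Prop :=
  I.P.Nonempty ∧ 1 ≤ I.k ∧ 1 ≤ I.r

/-- The point of `ℝ^d` given by a bit vector. -/
def toReal {d : ℕ} (a : Fin d → Bool) : Fin d → ℝ := fun i => if a i then 1 else 0

/-- The `k`-means cost of `P` for centers `c₁, …, c_k ∈ ℝ^d` and the assignment `σ` of the points
to the centers. -/
def cost (I : KMeansInstance) (c : Fin I.k → Fin I.d → ℝ) (σ : (Fin I.d → Bool) → Fin I.k) : ℝ :=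
  ∑ a ∈ I.P, l1Dist (toReal a) (c (σ a)) ^ 2

end KMeansInstance

/-- Continuous `k`-means in `ℓ₁`, for `n` points of `{0,1}^d` with `d ≤ K · log (n + 1)`: is the
optimal cost at most `r² · n`, or is it at least `F · r² · n`? -/
def kMeansGap (K F : ℝ) : PromiseProblem where
  yes := {x | ∃ I : KMeansInstance, I.Encodes x ∧ I.Valid ∧
    (I.d : ℝ) ≤ K * Real.log (I.P.card + 1) ∧
    ∃ c σ, I.cost c σ ≤ (I.r : ℝ) ^ 2 * I.P.card}
  no := {x | ∃ I : KMeansInstance, I.Encodes x ∧ I.Valid ∧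
    (I.d : ℝ) ≤ K * Real.log (I.P.card + 1) ∧
    ∀ c σ, F * ((I.r : ℝ) ^ 2 * I.P.card) ≤ I.cost c σ}

/-- It is NP-hard to approximate continuous `k`-means in `ℓ₁` within the factor `F`, already for
`n` points of `{0,1}^d` with `d = O(log n)`. -/
def KMeansL1HardToApproximate (F : ℝ) : Prop :=
  ∃ K : ℝ, (kMeansGap K F).NPHard

/-! ## Polynomial-time computable functions between encoded types -/

/-! Every element of the universe that lies in some set of `E` receives a binary word of weight m,
the bit length of |E|, such that two words share at most m/D ones. A set T is mapped to the
disjunction of the words of its elements. With θ = 1 - 2z/D, the points of T and T' are at distance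
at least 2(z - |T ∩ T'|)mθ (`le_l1Dist`), while the point of a y-subset of T is within r = (z-y)m of
the point of T (`l1Dist_le`). So a full cover yields centers of cost at most r²|E|.

For soundness, let the centers be arbitrary. By the triangle inequality, two points assigned to one
center and closer to it than (z-s)mθ come from sets sharing more than s elements (`le_card_inter`).
For s = y, `card_le_of_intersecting` leaves O(n^(z-y-1)) such points per center. For s = y-1,
`exists_subset_or_card_le` shows that the sets at one center have a common y-subset or again number
only O(n^(z-y-1)). Density makes all exceptions together O(|E|/B). Hence, up to these, at most α|E|
points are closer than (z-y+1)mθ to their centers, and almost none are closer than (z-y)mθ; this is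
the bound in `le_sum_sq`. Large constants B and D bring the loss below ε.

The words are chosen greedily among the N^m concatenations of m unit vectors of length N = (4z)^D; a
moment bound (`pow_mul_length_filter_le`) shows that the pool lasts. Since N is constant, the pool
has size polynomial in |E| and the dimension Nm is O(log |E|). Polynomial running time is derived
from closure properties of `PolyComp`, above all `PolyComp.foldl`. Under JCH*, z - y = 1 and the
ratio of squares is 4, which gives 1 + 3/e. -/

theorem TreeProg.Runs.size_le {p : TreeProg} {x y : BTree} {t : ℕ} (h : p.Runs x y t) :
    y.size ≤ t := by
  induction h with
  | nil x => cases x <;> simp [BTree.size]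
  | id x => exact le_rfl
  | left x => cases x <;> simp [BTree.size, BTree.left]; omega
  | right x => cases x <;> simp [BTree.size, BTree.right]; omega
  | pair _ _ h1 h2 => simp only [BTree.size]; omega
  | _ => omega

theorem Polynomial.eval_nat_mono (T : Polynomial ℕ) {a b : ℕ} (h : a ≤ b) :
    T.eval a ≤ T.eval b := by
  simp only [Polynomial.eval_eq_sum_range]
  exact Finset.sum_le_sum fun i _ => Nat.mul_le_mul_left _ (Nat.pow_le_pow_left h i)

theorem BTree.size_pos (x : BTree) : 1 ≤ x.size := by
  cases x <;> simp [BTree.size]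

/-- Types whose elements are written as trees. -/
class TreeEncodable (X : Type) where
  /-- The tree of an element. -/
  encode : X → BTree

open TreeEncodable (encode)

instance : TreeEncodable Unit := ⟨fun _ => BTree.nil⟩
instance : TreeEncodable Bool := ⟨BTree.ofBool⟩
instance : TreeEncodable ℕ := ⟨BTree.ofNat⟩
instance {X Y : Type} [TreeEncodable X] [TreeEncodable Y] : TreeEncodable (X × Y) :=
  ⟨fun p => BTree.cons (encode p.1) (encode p.2)⟩
instance {X : Type} [TreeEncodable X] : TreeEncodable (List X) :=
  ⟨fun l => BTree.ofList (l.map encode)⟩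

section

variable {X Y Z A B : Type} [TreeEncodable X] [TreeEncodable Y] [TreeEncodable Z]
  [TreeEncodable A] [TreeEncodable B]

/-- The size of the encoding. -/
def encSize (x : X) : ℕ := (encode x).size

/-- `b` is bounded by a polynomial in the size of the encoding. -/
def PolyBounded (b : X → ℕ) : Prop := ∃ T : Polynomial ℕ, ∀ x, b x ≤ T.eval (encSize x)

/-- `f` is computable in polynomial time. -/
def PolyComp (f : X → Y) : Prop := PolyTime (encode : X → BTree) fun x => encode (f x)

theorem encSize_pos (x : X) : 1 ≤ encSize x := BTree.size_pos _

@[simp] theorem encSize_prod (p : X × Y) : encSize p = encSize p.1 + encSize p.2 + 1 := rfl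

@[simp] theorem encSize_nil : encSize ([] : List X) = 1 := rfl

@[simp] theorem encSize_cons (a : X) (l : List X) :
    encSize (a :: l) = encSize a + encSize l + 1 := rfl

theorem encSize_unit (u : Unit) : encSize u = 1 := rfl

theorem encSize_bool_le (b : Bool) : encSize b ≤ 3 := by
  cases b <;> simp [encSize, encode, BTree.ofBool, BTree.size]

theorem encode_nat (n : ℕ) : encode n = encode (List.replicate n ()) := by
  simp [encode, BTree.ofNat]

theorem encSize_nat (n : ℕ) : encSize n = 2 * n + 1 := by
  rw [encSize, encode_nat]
  change encSize _ = _
  induction n with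
  | zero => rfl
  | succ n ih => rw [List.replicate_succ, encSize_cons, ih, encSize_unit]; ring

theorem encSize_append (l l' : List X) : encSize (l ++ l') + 1 = encSize l + encSize l' := by
  induction l with
  | nil => simp; ring
  | cons a l ih => simp only [List.cons_append, encSize_cons]; omega

theorem encSize_reverse (l : List X) : encSize l.reverse = encSize l := by
  induction l with
  | nil => rfl
  | cons a l ih =>
    have := encSize_append l.reverse [a]
    simp only [List.reverse_cons, encSize_cons, encSize_nil] at *
    omega

theorem encSize_of_mem {a : X} {l : List X} (h : a ∈ l) : encSize a ≤ encSize l := by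
  induction l with
  | nil => simp at h
  | cons b l ih =>
    rcases List.mem_cons.1 h with rfl | h
    · simp; omega
    · have := ih h; simp; omega

theorem length_le_encSize (l : List X) : l.length ≤ encSize l := by
  induction l with
  | nil => simp
  | cons b l ih => simp; omega

theorem encSize_list_le {l : List X} {n M : ℕ} (hl : l.length ≤ n) (h : ∀ a ∈ l, encSize a ≤ M) :
    encSize l ≤ n * (M + 1) + 1 := by
  have : encSize l ≤ l.length * (M + 1) + 1 := by
    clear hl
    induction l with
    | nil => simp
    | cons b l ih =>
      have h1 := h b (by simp)
      have h2 := ih fun a ha => h a (by simp [ha])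
      simp only [encSize_cons, List.length_cons]
      linarith
  exact this.trans (by gcongr)

theorem encSize_sublist {l l' : List X} (h : l.Sublist l') : encSize l ≤ encSize l' := by
  induction h with
  | slnil => exact le_rfl
  | cons a _ ih => simp; omega
  | cons_cons a _ ih => simp; omega

/-! ### Polynomial bounds -/

namespace PolyBounded

theorem const (n : ℕ) : PolyBounded fun _ : X => n := ⟨Polynomial.C n, by simp⟩

theorem size : PolyBounded fun x : X => encSize x := ⟨Polynomial.X, by simp⟩

theorem mono {b c : X → ℕ} (hc : PolyBounded c) (h : ∀ x, b x ≤ c x) : PolyBounded b :=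
  hc.imp fun _ hT x => (h x).trans (hT x)

theorem add {b c : X → ℕ} (hb : PolyBounded b) (hc : PolyBounded c) :
    PolyBounded fun x => b x + c x := by
  obtain ⟨T, hT⟩ := hb
  obtain ⟨S, hS⟩ := hc
  exact ⟨T + S, fun x => by rw [Polynomial.eval_add]; exact Nat.add_le_add (hT x) (hS x)⟩

theorem mul {b c : X → ℕ} (hb : PolyBounded b) (hc : PolyBounded c) :
    PolyBounded fun x => b x * c x := by
  obtain ⟨T, hT⟩ := hb
  obtain ⟨S, hS⟩ := hc
  exact ⟨T * S, fun x => by rw [Polynomial.eval_mul]; exact Nat.mul_le_mul (hT x) (hS x)⟩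

theorem pow {b : X → ℕ} (hb : PolyBounded b) (n : ℕ) : PolyBounded fun x => b x ^ n := by
  obtain ⟨T, hT⟩ := hb
  exact ⟨T ^ n, fun x => by rw [Polynomial.eval_pow]; exact Nat.pow_le_pow_left (hT x) n⟩

theorem eval (T : Polynomial ℕ) {b : X → ℕ} (hb : PolyBounded b) :
    PolyBounded fun x => T.eval (b x) := by
  obtain ⟨S, hS⟩ := hb
  exact ⟨T.comp S, fun x => by rw [Polynomial.eval_comp]; exact T.eval_nat_mono (hS x)⟩

theorem fst {b : X → ℕ} (hb : PolyBounded b) : PolyBounded fun p : X × Y => b p.1 := by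
  obtain ⟨S, hS⟩ := hb
  exact ⟨S, fun p => (hS p.1).trans (S.eval_nat_mono (by simp; omega))⟩

theorem snd {b : Y → ℕ} (hb : PolyBounded b) : PolyBounded fun p : X × Y => b p.2 := by
  obtain ⟨S, hS⟩ := hb
  exact ⟨S, fun p => (hS p.2).trans (S.eval_nat_mono (by simp; omega))⟩

end PolyBounded

/-! ### Closure properties -/

namespace PolyComp

theorem of_bound {f : X → Y} (p : TreeProg) (b : X → ℕ) (hb : PolyBounded b)
    (h : ∀ x, ∃ t ≤ b x, p.Runs (encode x) (encode (f x)) t) : PolyComp f := by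
  obtain ⟨T, hT⟩ := hb
  refine ⟨p, T, fun x => ?_⟩
  obtain ⟨t, ht, hr⟩ := h x
  exact ⟨t, ht.trans (hT x), hr⟩

theorem size {f : X → Y} (hf : PolyComp f) : PolyBounded fun x => encSize (f x) := by
  obtain ⟨p, T, h⟩ := hf
  refine ⟨T, fun x => ?_⟩
  obtain ⟨t, ht, hr⟩ := h x
  exact hr.size_le.trans ht

theorem of_encode_eq {f : X → Y} (h : ∀ x, encode (f x) = encode x) : PolyComp f :=
  of_bound .id _ .size fun x => ⟨_, le_rfl, by rw [h]; exact .id _⟩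

theorem id : PolyComp fun x : X => x := of_encode_eq fun _ => rfl

/-- An output is no larger than the time spent on it, so the second program runs on an input of
polynomial size. -/
theorem comp {g : Y → Z} {f : X → Y} (hg : PolyComp g) (hf : PolyComp f) :
    PolyComp fun x => g (f x) := by
  obtain ⟨q, S, hq⟩ := hg
  have hs := PolyBounded.eval S hf.size
  obtain ⟨p, T, hp⟩ := hf
  refine of_bound (.seq p q) _ (((PolyBounded.eval T .size).add hs).add (.const 1)) fun x => ?_
  obtain ⟨s, hs, hr⟩ := hp x
  obtain ⟨t, ht, hr'⟩ := hq (f x)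
  change s ≤ T.eval (encSize x) at hs
  change t ≤ S.eval (encSize (f x)) at ht
  exact ⟨s + t + 1, by omega, .seq hr hr'⟩

theorem pair {f : X → Y} {g : X → Z} (hf : PolyComp f) (hg : PolyComp g) :
    PolyComp fun x => (f x, g x) := by
  obtain ⟨p, T, hp⟩ := hf
  obtain ⟨q, S, hq⟩ := hg
  refine ⟨.pair p q, T + S + 1, fun x => ?_⟩
  obtain ⟨s, hs, hr⟩ := hp x
  obtain ⟨t, ht, hr'⟩ := hq x
  exact ⟨s + t + 1, by simp; omega, .pair hr hr'⟩

theorem fst {f : X → Y × Z} (hf : PolyComp f) : PolyComp fun x => (f x).1 :=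
  comp (of_bound (f := Prod.fst) .left _ .size fun x => ⟨_, le_rfl, .left (encode x)⟩) hf

theorem snd {f : X → Y × Z} (hf : PolyComp f) : PolyComp fun x => (f x).2 :=
  comp (of_bound (f := Prod.snd) .right _ .size fun x => ⟨_, le_rfl, .right (encode x)⟩) hf

theorem const (y : Y) : PolyComp fun _ : X => y := by
  have (b : BTree) : PolyTime (encode : X → BTree) fun _ => b := by
    induction b with
    | nil => exact ⟨.nil, Polynomial.X, fun x => ⟨_, by simp, .nil _⟩⟩
    | cons a b ha hb =>
      obtain ⟨p, T, hp⟩ := ha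
      obtain ⟨q, S, hq⟩ := hb
      refine ⟨.pair p q, T + S + 1, fun x => ?_⟩
      obtain ⟨s, hs, hr⟩ := hp x
      obtain ⟨t, ht, hr'⟩ := hq x
      exact ⟨s + t + 1, by simp; omega, .pair hr hr'⟩
  exact this _

/-- A nonempty list has the same tree as the pair of its head and tail, so pairing already does the
work. -/
theorem cons {f : X → Y} {l : X → List Y} (hf : PolyComp f) (hl : PolyComp l) :
    PolyComp fun x => f x :: l x :=
  comp (of_encode_eq (f := fun p : Y × List Y => p.1 :: p.2) fun _ => rfl) (pair hf hl)

/-- Branching on whether the encoding of `c x` is `nil`. -/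
theorem branch {c : X → Y} {f g h : X → Z} (hc : PolyComp c) (hf : PolyComp f) (hg : PolyComp g)
    (h1 : ∀ x, encode (c x) ≠ BTree.nil → h x = f x)
    (h2 : ∀ x, encode (c x) = BTree.nil → h x = g x) : PolyComp h := by
  obtain ⟨r, R, hr⟩ := hc
  obtain ⟨p, T, hp⟩ := hf
  obtain ⟨q, S, hq⟩ := hg
  refine ⟨.ite r p q, R + T + S + 1, fun x => ?_⟩
  obtain ⟨u, hu, hr⟩ := hr x
  obtain ⟨s, hs, hp⟩ := hp x
  obtain ⟨t, ht, hq⟩ := hq x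
  by_cases hx : encode (c x) = BTree.nil
  · exact ⟨u + t + 1, by simp; omega, .ite_false (hx ▸ hr) (by beta_reduce; rw [h2 x hx]; exact hq)⟩
  · exact ⟨u + s + 1, by simp; omega, .ite_true hr hx (by beta_reduce; rw [h1 x hx]; exact hp)⟩

theorem ite {c : X → Bool} {f g : X → Z} (hc : PolyComp c) (hf : PolyComp f) (hg : PolyComp g) :
    PolyComp fun x => if c x then f x else g x := by
  refine branch hc hf hg (fun x h => ?_) fun x h => ?_ <;>
    cases hx : c x <;> simp_all [encode, BTree.ofBool]

/-- Case distinction on a list; `f` is only used on nonempty lists. -/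
theorem listCases {l : X → List Y} {g : X → Z} {f : X → Y → List Y → Z} (hl : PolyComp l)
    (hg : PolyComp g) (hf : PolyComp fun p : X × Y × List Y => f p.1 p.2.1 p.2.2) :
    PolyComp fun x => match l x with
      | [] => g x
      | a :: t => f x a t := by
  obtain ⟨r, R, hr⟩ := hl
  obtain ⟨q, S, hq⟩ := hg
  obtain ⟨p, T, hp⟩ := hf
  -- In the nonempty case the tree of `l x` is literally that of the pair (head, tail), so `.pair
  -- .id r` produces the input that `p` expects.
  refine of_bound (.ite r (.seq (.pair .id r) p) q) (fun x => R.eval (encSize x) +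
    S.eval (encSize x) + (encSize x + R.eval (encSize x) + 1 +
      T.eval (encSize x + R.eval (encSize x) + 1) + 1) + 1) ?_ fun x => ?_
  · have hR : PolyBounded fun x : X => R.eval (encSize x) := .eval R .size
    have hS : PolyBounded fun x : X => S.eval (encSize x) := .eval S .size
    exact (((hR.add hS).add ((((PolyBounded.size.add hR).add (.const 1)).add
      (.eval T ((PolyBounded.size.add hR).add (.const 1)))).add (.const 1))).add (.const 1))
  · obtain ⟨u, hu, hr⟩ := hr x
    obtain ⟨t, ht, hq⟩ := hq x
    change u ≤ R.eval (encSize x) at hu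
    change t ≤ S.eval (encSize x) at ht
    rcases hx : l x with _ | ⟨a, m⟩
    · beta_reduce at hr
      rw [hx] at hr
      exact ⟨u + t + 1, by omega, .ite_false hr hq⟩
    · beta_reduce at hr
      rw [hx] at hr
      obtain ⟨s, hs, hp⟩ := hp (x, a, m)
      change s ≤ T.eval (encSize x + encSize (a :: m) + 1) at hs
      have h1 : encSize (a :: m) ≤ u := hr.size_le
      have h2 := T.eval_nat_mono
        (show encSize x + encSize (a :: m) + 1 ≤ encSize x + R.eval (encSize x) + 1 by omega)
      refine ⟨u + (encSize x + u + 1 + s + 1) + 1, by omega, .ite_true hr (by simp [encode,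
        BTree.ofList]) (.seq (.pair (.id _) hr) hp)⟩

/-- A loop over a list; the accumulator has to stay of polynomial size. -/
theorem foldl {f : X → B → A → B} {b : X → B} {l : X → List A}
    (hf : PolyComp fun p : X × B × A => f p.1 p.2.1 p.2.2) (hb : PolyComp b) (hl : PolyComp l)
    (hs : PolyBounded fun p : X × List A => encSize (p.2.foldl (f p.1) (b p.1))) :
    PolyComp fun x => (l x).foldl (f x) (b x) := by
  suffices key : ∃ p : TreeProg, ∃ c : X × List A → ℕ, PolyBounded c ∧ ∀ x l, ∃ t ≤ c (x, l),
      p.Runs (encode (x, b x, l)) (encode (x, l.foldl (f x) (b x), ([] : List A))) t by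
    obtain ⟨p, c, ⟨T, hT⟩, hp⟩ := key
    have hX : PolyComp fun x : X => (x, l x) := id.pair hl
    have h1 : PolyComp fun x : X => (x, b x, l x) := id.pair (hb.pair hl)
    have hcl : PolyBounded fun x => T.eval (encSize (x, l x)) := .eval T hX.size
    have h2 : PolyComp fun x : X => (x, (l x).foldl (f x) (b x), ([] : List A)) := by
      obtain ⟨q, S, hq⟩ := h1
      refine of_bound (.seq q p) _ (((PolyBounded.eval S .size).add hcl).add (.const 1))
        fun x => ?_
      obtain ⟨s, hs, hr⟩ := hq x
      obtain ⟨t, ht, hr'⟩ := hp x (l x)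
      have := hT (x, l x)
      exact ⟨s + t + 1, by change s ≤ S.eval (encSize x) at hs; omega, .seq hr hr'⟩
    exact h2.snd.fst
  have hbody : PolyComp fun p : X × B × A × List A => (p.1, f p.1 p.2.1 p.2.2.1, p.2.2.2) :=
    id.fst.pair ((hf.comp (id.fst.pair (id.snd.fst.pair id.snd.snd.fst))).pair id.snd.snd.snd)
  have hcond : PolyComp fun p : X × B × List A => p.2.2 := id.snd.snd
  obtain ⟨p, T, hp⟩ := hbody
  obtain ⟨q, S, hq⟩ := hcond
  obtain ⟨Q, hQ⟩ := hs
  -- `K` bounds the size of every loop state (input, accumulator, remaining list).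
  let K : X × List A → ℕ := fun w => encSize w.1 + Q.eval (encSize w) + encSize w.2 + 2
  have hK : PolyBounded K := (((PolyBounded.size.fst).add (.eval Q .size)).add
    PolyBounded.size.snd).add (.const 2)
  refine ⟨.loop q p, fun w => (encSize w.2 + 1) * (T.eval (K w) + S.eval (K w) + K w + 1),
    (PolyBounded.size.snd.add (.const 1)).mul (((PolyBounded.eval T hK).add (.eval S hK)).add hK
      |>.add (.const 1)), fun x l => ?_⟩
  have main : ∀ l₂ l₁, l = l₁ ++ l₂ → ∃ t ≤ (l₂.length + 1) *
      (T.eval (K (x, l)) + S.eval (K (x, l)) + K (x, l) + 1), (TreeProg.loop q p).Runs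
        (encode (x, l₁.foldl (f x) (b x), l₂))
        (encode (x, l.foldl (f x) (b x), ([] : List A))) t := by
    intro l₂
    induction l₂ with
    | nil =>
      intro l₁ h
      rw [List.append_nil] at h
      subst h
      obtain ⟨t, ht, hr⟩ := hq (x, l.foldl (f x) (b x), [])
      have h1 : encSize (x, l.foldl (f x) (b x), ([] : List A)) ≤ K (x, l) := by
        have := hQ (x, l)
        have := encSize_pos l
        simp only [encSize_prod, encSize_nil, K] at *
        omega
      change t ≤ S.eval (encSize _) at ht
      have h2 := S.eval_nat_mono h1
      refine ⟨t + encSize (x, l.foldl (f x) (b x), ([] : List A)) + 1, ?_, .loop_done hr⟩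
      simp only [List.length_nil, zero_add, one_mul]
      omega
    | cons a l₂ ih =>
      intro l₁ h
      obtain ⟨u, hu, hr⟩ := ih (l₁ ++ [a]) (by simp [h])
      rw [List.foldl_append] at hr
      obtain ⟨t, ht, hr'⟩ := hq (x, l₁.foldl (f x) (b x), a :: l₂)
      obtain ⟨s, hs, hr''⟩ := hp (x, l₁.foldl (f x) (b x), a, l₂)
      have h1 : encSize (x, l₁.foldl (f x) (b x), a :: l₂) ≤ K (x, l) := by
        -- The size hypothesis covers all lists, so it applies to the prefix processed so far and
        -- controls the intermediate accumulator.
        have h3 := hQ (x, l₁)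
        have h4 := encSize_append l₁ (a :: l₂)
        have h7 := encSize_pos (a :: l₂)
        have h8 := encSize_pos l₁
        rw [← h] at h4
        have h5 : encSize (x, l₁) ≤ encSize (x, l) := by
          simp only [encSize_prod]; omega
        have h6 := Q.eval_nat_mono h5
        simp only [encSize_prod, K] at *
        omega
      change t ≤ S.eval (encSize _) at ht
      change s ≤ T.eval (encSize (x, l₁.foldl (f x) (b x), a :: l₂)) at hs
      have h2 := S.eval_nat_mono h1
      have h3 := T.eval_nat_mono h1
      refine ⟨t + s + u + 1, ?_, .loop_step hr' (by simp [encode, BTree.ofList]) hr'' hr⟩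
      rw [List.length_cons, add_mul _ 1]
      omega
  obtain ⟨t, ht, hr⟩ := main l [] rfl
  exact ⟨t, ht.trans (Nat.mul_le_mul_right _ (Nat.add_le_add_right (length_le_encSize l) 1)), hr⟩

end PolyComp

end

/-! ### List operations and unary arithmetic in polynomial time -/

namespace PolyComp

/-- The step of a loop that computes `List.zip`. -/
def zipStep {A B : Type} (s : List B × List (A × B)) (a : A) : List B × List (A × B) :=
  match s.1 with
  | [] => ([], s.2)
  | b :: m => (m, (a, b) :: s.2)

theorem foldl_zipStep {A B : Type} (l : List A) (m : List B) (acc : List (A × B)) :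
    l.foldl zipStep (m, acc) = (m.drop l.length, (l.zip m).reverse ++ acc) := by
  induction l generalizing m acc with
  | nil => rfl
  | cons a l ih => cases m <;> simp [zipStep, ih]

variable {X Y Z A B : Type} [TreeEncodable X] [TreeEncodable Y] [TreeEncodable Z]
  [TreeEncodable A] [TreeEncodable B]

theorem foldl_cons_eq {α : Type*} (l l' : List α) :
    l.foldl (fun acc a => a :: acc) l' = l.reverse ++ l' := by
  induction l generalizing l' with
  | nil => rfl
  | cons a l ih => simp [ih]

theorem reverse {l : X → List A} (hl : PolyComp l) : PolyComp fun x => (l x).reverse := by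
  have : PolyComp fun x => (l x).foldl (fun acc a => a :: acc) [] := by
    refine foldl (f := fun _ acc a => a :: acc) (b := fun _ => []) (cons id.snd.snd id.snd.fst)
      (const _) hl (PolyBounded.size.snd.mono fun p => ?_)
    rw [foldl_cons_eq, List.append_nil, encSize_reverse]
  simpa only [foldl_cons_eq, List.append_nil] using this

theorem append {l l' : X → List A} (hl : PolyComp l) (hl' : PolyComp l') :
    PolyComp fun x => l x ++ l' x := by
  have : PolyComp fun x => (l x).reverse.foldl (fun acc a => a :: acc) (l' x) := by
    refine foldl (f := fun _ acc a => a :: acc) (cons id.snd.snd id.snd.fst)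
      hl' hl.reverse ((PolyBounded.size.snd.add hl'.size.fst).mono fun p => ?_)
    have := encSize_append p.2.reverse (l' p.1)
    rw [foldl_cons_eq]
    rw [encSize_reverse] at this
    omega
  simpa only [foldl_cons_eq, List.reverse_reverse] using this

theorem map {f : X → A → B} {l : X → List A} (hf : PolyComp fun p : X × A => f p.1 p.2)
    (hl : PolyComp l) : PolyComp fun x => (l x).map (f x) := by
  have key (x : X) (l : List A) (acc : List B) :
      l.foldl (fun acc a => f x a :: acc) acc = (l.map (f x)).reverse ++ acc := by
    induction l generalizing acc with
    | nil => rfl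
    | cons a l ih => simp [ih]
  -- Accumulating with cons reverses the order, hence the loop over the reversed list.
  have : PolyComp fun x => (l x).reverse.foldl (fun acc a => f x a :: acc) [] := by
    obtain ⟨T, hT⟩ := hf.size
    refine foldl (f := fun x acc a => f x a :: acc) (b := fun _ => [])
      (cons (hf.comp (id.fst.pair id.snd.snd)) id.snd.fst) (const _) hl.reverse
      (((PolyBounded.size.mul ((PolyBounded.eval T .size).add (.const 1))).add
        (.const 1)).mono fun p => ?_)
    rw [key, List.append_nil, encSize_reverse]
    refine encSize_list_le ?_ ?_
    · rw [List.length_map]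
      have := length_le_encSize p.2
      simp; omega
    · intro b hb
      obtain ⟨a, ha, rfl⟩ := List.mem_map.1 hb
      have := encSize_of_mem ha
      exact (hT (p.1, a)).trans (T.eval_nat_mono (by simp; omega))
  simpa only [key, List.append_nil, List.map_reverse, List.reverse_reverse] using this

theorem filter {c : X → A → Bool} {l : X → List A} (hc : PolyComp fun p : X × A => c p.1 p.2)
    (hl : PolyComp l) : PolyComp fun x => (l x).filter (c x) := by
  have key (x : X) (l : List A) (acc : List A) :
      l.foldl (fun acc a => if c x a then a :: acc else acc) acc
        = (l.filter (c x)).reverse ++ acc := by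
    induction l generalizing acc with
    | nil => rfl
    | cons a l ih => cases h : c x a <;> simp [ih, h]
  have : PolyComp fun x =>
      (l x).reverse.foldl (fun acc a => if c x a then a :: acc else acc) [] := by
    refine foldl (f := fun x acc a => if c x a then a :: acc else acc) (b := fun _ => [])
      (ite (hc.comp (id.fst.pair id.snd.snd)) (cons id.snd.snd id.snd.fst) id.snd.fst) (const _)
      hl.reverse (PolyBounded.size.snd.mono fun p => ?_)
    rw [key, List.append_nil, encSize_reverse]
    exact encSize_sublist List.filter_sublist
  simpa only [key, List.append_nil, List.filter_reverse, List.reverse_reverse] using this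

theorem encSize_zip_le (l : List A) (m : List B) : encSize (l.zip m) ≤ encSize l + encSize m := by
  induction l generalizing m with
  | nil => simp
  | cons a l ih =>
    cases m with
    | nil => simp
    | cons b m =>
      have := ih m
      simp only [List.zip_cons_cons, encSize_cons, encSize_prod]
      omega

theorem zip {l : X → List A} {m : X → List B} (hl : PolyComp l) (hm : PolyComp m) :
    PolyComp fun x => (l x).zip (m x) := by
  have : PolyComp fun x => (l x).foldl zipStep (m x, []) := by
    refine foldl (f := fun _ => zipStep) (b := fun x => (m x, ([] : List (A × B))))
      ?_ (hm.pair (const _)) hl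
      (((hm.size.fst.add PolyBounded.size.snd).add (hm.size.fst.add (.const 1))).mono fun p => ?_)
    · exact listCases (g := fun p : X × (List B × List (A × B)) × A => (([] : List B), p.2.1.2))
        (f := fun p b t => (t, (p.2.2, b) :: p.2.1.2)) id.snd.fst.fst
        ((const _).pair id.snd.fst.snd)
        (id.snd.snd.pair (cons (id.fst.snd.snd.pair id.snd.fst) id.fst.snd.fst.snd))
    · rw [foldl_zipStep, encSize_prod, List.append_nil, encSize_reverse]
      have h1 := encSize_zip_le p.2 (m p.1)
      have h2 := encSize_sublist (List.drop_sublist p.2.length (m p.1))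
      dsimp only
      omega
  simpa only [foldl_zipStep, List.append_nil, List.reverse_reverse] using this.snd.reverse

theorem zipWith {f : X → A → B → Y} {l : X → List A} {m : X → List B}
    (hf : PolyComp fun p : X × A × B => f p.1 p.2.1 p.2.2) (hl : PolyComp l) (hm : PolyComp m) :
    PolyComp fun x => (l x).zipWith (f x) (m x) := by
  have := map (f := fun x (p : A × B) => f x p.1 p.2) hf (hl.zip hm)
  simpa only [List.zip, List.map_zipWith] using this

theorem and {b c : X → Bool} (hb : PolyComp b) (hc : PolyComp c) :
    PolyComp fun x => b x && c x := by
  have := ite hb hc (const false)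
  convert this using 3 with x
  cases b x <;> simp

theorem or {b c : X → Bool} (hb : PolyComp b) (hc : PolyComp c) :
    PolyComp fun x => b x || c x := by
  have := ite hb (const true) hc
  convert this using 3 with x
  cases b x <;> simp

theorem replicate_unit {n : X → ℕ} (hn : PolyComp n) :
    PolyComp fun x => List.replicate (n x) () :=
  comp (g := fun n => List.replicate n ()) (of_encode_eq fun n => (encode_nat n).symm) hn

theorem length_unit {l : X → List Unit} (hl : PolyComp l) : PolyComp fun x => (l x).length := by
  refine comp (g := fun l : List Unit => l.length) (of_encode_eq fun l => ?_) hl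
  rw [encode_nat]
  congr 1
  exact (List.eq_replicate_of_mem fun _ _ => rfl).symm

theorem length {l : X → List A} (hl : PolyComp l) : PolyComp fun x => (l x).length := by
  simpa using length_unit (map (f := fun _ _ => ()) (const _) hl)

theorem replicate {n : X → ℕ} {a : X → A} (hn : PolyComp n) (ha : PolyComp a) :
    PolyComp fun x => List.replicate (n x) (a x) := by
  simpa using map (f := fun x (_ : Unit) => a x) (ha.comp id.fst) hn.replicate_unit

theorem natAdd {m n : X → ℕ} (hm : PolyComp m) (hn : PolyComp n) :
    PolyComp fun x => m x + n x := by
  simpa using length (hm.replicate_unit.append hn.replicate_unit)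

theorem const_mul (c : ℕ) {n : X → ℕ} (hn : PolyComp n) : PolyComp fun x => c * n x := by
  induction c with
  | zero => simpa using const 0
  | succ c ih => simpa only [add_mul, one_mul] using ih.natAdd hn

theorem tail {l : X → List A} (hl : PolyComp l) : PolyComp fun x => (l x).tail := by
  have := listCases (g := fun _ => []) (f := fun _ _ t => t) hl (const _) id.snd.snd
  convert this using 2 with x
  cases l x <;> rfl

theorem headD {l : X → List A} {a : X → A} (hl : PolyComp l) (ha : PolyComp a) :
    PolyComp fun x => (l x).headD (a x) := by
  have := listCases (g := a) (f := fun _ b _ => b) hl ha id.snd.fst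
  convert this using 2 with x
  cases l x <;> rfl

/-- Repetition; the accumulator has to stay of polynomial size. -/
theorem iterate {f : X → B → B} {b : X → B} {n : X → ℕ} (hf : PolyComp fun p : X × B => f p.1 p.2)
    (hb : PolyComp b) (hn : PolyComp n)
    (hs : PolyBounded fun p : X × ℕ => encSize ((f p.1)^[p.2] (b p.1))) :
    PolyComp fun x => (f x)^[n x] (b x) := by
  have key (x : X) (l : List Unit) (b : B) : l.foldl (fun b _ => f x b) b = (f x)^[l.length] b := by
    induction l generalizing b with
    | nil => rfl
    | cons a l ih => simp [ih]
  obtain ⟨T, hT⟩ := hs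
  have := foldl (f := fun x b (_ : Unit) => f x b) (hf.comp (id.fst.pair id.snd.fst)) hb
    hn.replicate_unit ((PolyBounded.eval T .size).mono fun p => ?_)
  · simpa only [key, List.length_replicate] using this
  · rw [key]
    refine (hT (p.1, p.2.length)).trans (T.eval_nat_mono ?_)
    have : encSize p.2.length = encSize p.2 := by
      rw [encSize, encode_nat]
      congr 2
      exact (List.eq_replicate_of_mem fun _ _ => rfl).symm
    simp [this]

theorem natSub {m n : X → ℕ} (hm : PolyComp m) (hn : PolyComp n) :
    PolyComp fun x => m x - n x := by
  have key (n m : ℕ) : (fun a => a - 1)^[n] m = m - n := by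
    induction n generalizing m with
    | zero => rfl
    | succ n ih => rw [Function.iterate_succ_apply, ih]; omega
  have := iterate (f := fun _ a => a - 1) ?_ hm hn (hm.size.fst.mono fun p => ?_)
  · simpa only [key] using this
  · simpa using length_unit (id.snd.replicate_unit.tail : PolyComp fun p : X × ℕ => _)
  · rw [key, encSize_nat, encSize_nat]; omega

theorem natPos {n : X → ℕ} (hn : PolyComp n) : PolyComp fun x => decide (0 < n x) := by
  have := listCases (g := fun _ => false) (f := fun _ _ _ => true) hn.replicate_unit (const _)
    (const _)
  convert this using 2 with x
  cases n x <;> simp [List.replicate_succ]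

theorem natLT {m n : X → ℕ} (hm : PolyComp m) (hn : PolyComp n) :
    PolyComp fun x => decide (m x < n x) := by
  simpa using (hn.natSub hm).natPos

theorem natHalf {n : X → ℕ} (hn : PolyComp n) : PolyComp fun x => n x / 2 := by
  -- The state holds the rounded-down and rounded-up halves; passing to the successor swaps them and
  -- adds one.
  have key (n : ℕ) : (fun p : ℕ × ℕ => (p.2, p.1 + 1))^[n] (0, 0) = (n / 2, (n + 1) / 2) := by
    induction n with
    | zero => rfl
    | succ n ih => rw [Function.iterate_succ_apply', ih]; simp; omega
  have := iterate (f := fun _ (p : ℕ × ℕ) => (p.2, p.1 + 1)) (b := fun _ => (0, 0))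
    (id.snd.snd.pair (id.snd.fst.natAdd (const 1))) (const _) hn
    (((PolyBounded.size.snd).add (.const 2)).mono fun p => ?_)
  · simpa only [key] using this.fst
  · rw [key, encSize_prod]
    simp only [encSize_nat]
    omega

theorem count_true {l : X → List Bool} (hl : PolyComp l) : PolyComp fun x => (l x).count true := by
  have := length (filter (c := fun _ b => b) id.snd hl)
  convert this using 2 with x
  rw [List.count, List.countP_eq_length_filter]
  simp

end PolyComp

/-! ## The reduction as a function on lists -/

/-- The unit vectors of length `N`. -/
def oneHots (N : ℕ) : List (List Bool) :=
  List.ofFn fun i : Fin N => List.ofFn fun j : Fin N => decide (j = i)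

/-- Prepend a unit vector to every word, in all possible ways. -/
def extendWords (N : ℕ) (W : List (List Bool)) : List (List Bool) :=
  W.flatMap fun w => (oneHots N).map fun b => b ++ w

/-- All concatenations of `m` unit vectors of length `N`. -/
def oneHotWords (N : ℕ) : ℕ → List (List Bool)
  | 0 => [[]]
  | m + 1 => extendWords N (oneHotWords N m)

/-- The number of common ones of two bit vectors. -/
def commonOnes (w x : List Bool) : ℕ := (List.zipWith (fun a b => a && b) w x).count true

/-- Choose one word from the pool for every `true`, and discard all words that have
too much in common with the chosen one. -/
def greedyCode (D m : ℕ) : List (List Bool) → List Bool → List (List Bool)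
  | _, [] => []
  | R, false :: U => [] :: greedyCode D m R U
  | R, true :: U => R.headD [] ::
      greedyCode D m (R.filter fun x => decide (D * commonOnes (R.headD []) x < m)) U

/-- The bitwise disjunction of a list of bit vectors. -/
def orAll (w : List Bool) (l : List (List Bool)) : List Bool :=
  l.foldl (fun a b => List.zipWith (fun c d => c || d) a b) w

/-- The disjunction of the code words of the elements of a set. -/
def embedSet (d : ℕ) (code : List (List Bool)) (T : List Bool) : List Bool :=
  orAll (List.replicate d false) (((T.zip code).filter fun p => p.1).map fun p => p.2)

/-- The code for the used elements of the universe. -/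
def coverCode (D N n : ℕ) (E : List (List Bool)) : List (List Bool) :=
  greedyCode D E.length.size (oneHotWords N E.length.size) (orAll (List.replicate n false) E)

/-- The reduction from Johnson coverage to `k`-means; `j` is the difference of the set sizes. -/
def kMeansReduction (D N j : ℕ) (I : ℕ × ℕ × List (List Bool)) :
    ℕ × ℕ × ℕ × List (List Bool) :=
  (N * I.2.2.length.size, I.2.1, j * I.2.2.length.size,
    I.2.2.map (embedSet (N * I.2.2.length.size) (coverCode D N I.1 I.2.2)))

/-! ### Lengths of the words and size of the pool -/

theorem length_of_mem_oneHots {N : ℕ} {b : List Bool} (h : b ∈ oneHots N) : b.length = N := by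
  obtain ⟨i, rfl⟩ := List.mem_ofFn.1 h
  simp

theorem length_oneHotWords (N m : ℕ) : (oneHotWords N m).length = N ^ m := by
  induction m with
  | zero => rfl
  | succ m ih => simp [oneHotWords, extendWords, List.length_flatMap, oneHots, ih, pow_succ]

theorem mem_oneHotWords_succ {N m : ℕ} {w : List Bool} :
    w ∈ oneHotWords N (m + 1) ↔ ∃ b ∈ oneHots N, ∃ v ∈ oneHotWords N m, w = b ++ v := by
  simp only [oneHotWords, extendWords, List.mem_flatMap, List.mem_map]
  constructor
  · rintro ⟨v, hv, b, hb, rfl⟩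
    exact ⟨b, hb, v, hv, rfl⟩
  · rintro ⟨b, hb, v, hv, rfl⟩
    exact ⟨v, hv, b, hb, rfl⟩

theorem length_of_mem_oneHotWords {N m : ℕ} {w : List Bool} (h : w ∈ oneHotWords N m) :
    w.length = N * m := by
  induction m generalizing w with
  | zero => simp [oneHotWords] at h; simp [h]
  | succ m ih =>
    obtain ⟨b, hb, v, hv, rfl⟩ := mem_oneHotWords_succ.1 h
    rw [List.length_append, length_of_mem_oneHots hb, ih hv]
    ring

theorem length_greedyCode (D m : ℕ) (R : List (List Bool)) (U : List Bool) :
    (greedyCode D m R U).length = U.length := by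
  induction U generalizing R with
  | nil => rfl
  | cons b U ih => cases b <;> simp [greedyCode, ih]

theorem two_pow_size_le (n : ℕ) : 2 ^ n.size ≤ 2 * n + 1 := by
  rcases h : n.size with _ | s
  · simp
  · have := Nat.lt_size.1 (show s < n.size by omega)
    rw [pow_succ]
    omega

theorem encSize_bits_le (w : List Bool) : encSize w ≤ w.length * 4 + 1 :=
  encSize_list_le le_rfl fun b _ => encSize_bool_le b

theorem length_orAll_le (w : List Bool) (l : List (List Bool)) :
    (orAll w l).length ≤ w.length := by
  induction l generalizing w with
  | nil => exact le_rfl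
  | cons a l ih => exact (ih _).trans (by simp)

/-! ### The reduction runs in polynomial time -/

namespace PolyComp

variable {X A B : Type} [TreeEncodable X] [TreeEncodable A] [TreeEncodable B]

theorem flatMap {f : X → A → List B} {l : X → List A} (hf : PolyComp fun p : X × A => f p.1 p.2)
    (hl : PolyComp l) : PolyComp fun x => (l x).flatMap (f x) := by
  have key (x : X) (l : List A) (acc : List B) :
      l.foldl (fun acc a => acc ++ f x a) acc = acc ++ l.flatMap (f x) := by
    induction l generalizing acc with
    | nil => simp
    | cons a l ih => simp [ih]
  obtain ⟨T, hT⟩ := hf.size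
  have := foldl (f := fun x acc a => acc ++ f x a) (b := fun _ => [])
    (append id.snd.fst (hf.comp (id.fst.pair id.snd.snd))) (const _) hl
    (((PolyBounded.size.mul (PolyBounded.eval T .size)).add (.const 1)).mono fun p => ?_)
  · simpa only [key, List.nil_append] using this
  · rw [key, List.nil_append]
    have h1 : ∀ m : List A, (∀ a ∈ m, a ∈ p.2) →
        encSize (m.flatMap (f p.1)) ≤ m.length * T.eval (encSize p) + 1 := by
      intro m hm
      induction m with
      | nil => simp
      | cons a m ih =>
        have h2 := ih fun a ha => hm a (by simp [ha])
        have h3 := encSize_append (f p.1 a) (m.flatMap (f p.1))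
        have h4 := encSize_of_mem (hm a (by simp))
        have h5 : encSize (f p.1 a) ≤ _ := (hT (p.1, a)).trans (T.eval_nat_mono
          (show encSize (p.1, a) ≤ encSize p by simp; omega))
        simp only [List.flatMap_cons, List.length_cons, add_mul, one_mul]
        omega
    refine (h1 p.2 fun _ h => h).trans (Nat.add_le_add_right (Nat.mul_le_mul_right _ ?_) 1)
    exact (length_le_encSize p.2).trans (by simp; omega)

theorem extendWords (N : ℕ) {W : X → List (List Bool)} (hW : PolyComp W) :
    PolyComp fun x => extendWords N (W x) :=
  flatMap (f := fun _ w => (oneHots N).map fun b => b ++ w)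
    (map (f := fun (p : X × List Bool) b => b ++ p.2) (append id.snd id.fst.snd) (const _)) hW

theorem commonOnes {w x : X → List Bool} (hw : PolyComp w) (hx : PolyComp x) :
    PolyComp fun a => commonOnes (w a) (x a) :=
  count_true (zipWith (f := fun _ a b => a && b) (and id.snd.fst id.snd.snd) hw hx)

theorem orAll {w : X → List Bool} {l : X → List (List Bool)} (hw : PolyComp w) (hl : PolyComp l) :
    PolyComp fun x => orAll (w x) (l x) := by
  refine foldl (f := fun _ a b => List.zipWith (fun c d => c || d) a b)
    (zipWith (f := fun _ c d => c || d) (or id.snd.fst id.snd.snd) id.snd.fst id.snd.snd) hw hl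
    (((hw.size.fst.mul (.const 4)).add (.const 1)).mono fun p => ?_)
  refine (encSize_bits_le _).trans ?_
  have h1 := length_orAll_le (w p.1) p.2
  have h2 := length_le_encSize (w p.1)
  rw [_root_.orAll] at h1
  omega

theorem embedSet {d : X → ℕ} {code : X → List (List Bool)} {T : X → List Bool} (hd : PolyComp d)
    (hc : PolyComp code) (hT : PolyComp T) : PolyComp fun x => embedSet (d x) (code x) (T x) :=
  orAll (replicate hd (const false)) (map (f := fun _ p => p.2) id.snd.snd
    (filter (c := fun _ p => p.1) id.snd.fst (hT.zip hc)))

/-- The step of a loop that computes `greedyCode`. -/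
def greedyStep (D m : ℕ) (s : List (List Bool) × List (List Bool)) (b : Bool) :
    List (List Bool) × List (List Bool) :=
  if b then (s.1.filter fun x => decide (D * _root_.commonOnes (s.1.headD []) x < m),
    s.1.headD [] :: s.2) else (s.1, [] :: s.2)

/-- The sublist half serves only to bound the size of the accumulator. -/
theorem foldl_greedyStep (D m : ℕ) (U : List Bool) (R out : List (List Bool)) :
    (U.foldl (greedyStep D m) (R, out)).1.Sublist R ∧
    (U.foldl (greedyStep D m) (R, out)).2 = (greedyCode D m R U).reverse ++ out := by
  induction U generalizing R out with
  | nil => simp [greedyCode]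
  | cons b U ih =>
    cases b
    · simp [greedyStep, ih, greedyCode]
    · simp only [List.foldl_cons, greedyStep, if_true, ih, greedyCode, List.reverse_cons,
        List.append_assoc, List.singleton_append, and_true]
      exact (ih _ _).1.trans List.filter_sublist

theorem encSize_le_of_mem_greedyCode {D m : ℕ} {U : List Bool} {R : List (List Bool)}
    {w : List Bool} (h : w ∈ greedyCode D m R U) : encSize w ≤ encSize R := by
  induction U generalizing R with
  | nil => simp [greedyCode] at h
  | cons b U ih =>
    cases b
    · rcases List.mem_cons.1 h with rfl | h
      · exact encSize_pos R
      · exact ih h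
    · rcases List.mem_cons.1 h with rfl | h
      · cases R with
        | nil => exact le_rfl
        | cons a R => exact encSize_of_mem (by simp)
      · exact (ih h).trans (encSize_sublist List.filter_sublist)

theorem greedyCode (D : ℕ) {m : X → ℕ} {R : X → List (List Bool)} {U : X → List Bool}
    (hm : PolyComp m) (hR : PolyComp R) (hU : PolyComp U) :
    PolyComp fun x => greedyCode D (m x) (R x) (U x) := by
  have := foldl (f := fun x => greedyStep D (m x)) (b := fun x => (R x, [])) (l := U) ?_
    (hR.pair (const _)) hU ((hR.size.fst.add (((PolyBounded.size.snd.mul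
      (hR.size.fst.add (.const 1)))).add (.const 2))).mono fun p => ?_)
  · simpa only [(foldl_greedyStep _ _ _ _ _).2, List.append_nil, List.reverse_reverse] using
      this.snd.reverse
  · have hhead : PolyComp fun p : X × (List (List Bool) × List (List Bool)) × Bool =>
        p.2.1.1.headD [] := headD id.snd.fst.fst (const [])
    refine ite id.snd.snd (pair ?_ (cons hhead id.snd.fst.snd))
      (id.snd.fst.fst.pair (cons (const []) id.snd.fst.snd))
    exact filter (c := fun (p : X × (List (List Bool) × List (List Bool)) × Bool) x =>
      decide (D * _root_.commonOnes (p.2.1.1.headD []) x < m p.1))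
      (natLT (const_mul D (commonOnes (hhead.comp id.fst) id.snd)) (hm.comp id.fst.fst))
      id.snd.fst.fst
  · obtain ⟨h1, h2⟩ := foldl_greedyStep D (m p.1) p.2 (R p.1) []
    rw [encSize_prod, h2, List.append_nil, encSize_reverse]
    have h3 := encSize_list_le (length_greedyCode D (m p.1) (R p.1) p.2).le
      fun a ha => encSize_le_of_mem_greedyCode ha
    have h4 := encSize_sublist h1
    have h5 := Nat.mul_le_mul_right (encSize (R p.1) + 1) (length_le_encSize p.2)
    omega

/-- The step of a loop that computes binary logarithms. -/
def logStep (N : ℕ) (s : ℕ × List (List Bool) × ℕ) : ℕ × List (List Bool) × ℕ :=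
  if decide (0 < s.1) then (s.1 / 2, _root_.extendWords N s.2.1, s.2.2 + 1) else s

/-- Halving reaches zero after exactly `n.size` rounds, and then the state is frozen. Running `n`
rounds is therefore safe, without knowing the logarithm beforehand. -/
theorem iterate_logStep (N n j : ℕ) : (logStep N)^[j] (n, [[]], 0) =
    (n / 2 ^ j, oneHotWords N (min j n.size), min j n.size) := by
  induction j with
  | zero => simp [oneHotWords]
  | succ j ih =>
    rw [Function.iterate_succ_apply', ih, logStep]
    by_cases h : j < n.size
    · have h1 : 0 < n / 2 ^ j := Nat.div_pos (Nat.lt_size.1 h) (by positivity)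
      rw [if_pos (by simpa using h1), min_eq_left h.le, min_eq_left (Nat.succ_le_of_lt h),
        Nat.div_div_eq_div_mul, ← pow_succ]
      rfl
    · have h1 : n < 2 ^ j := Nat.size_le.1 (not_lt.1 h)
      have h2 : n < 2 ^ (j + 1) := h1.trans_le (Nat.pow_le_pow_right (by simp) (by simp))
      rw [min_eq_right (not_lt.1 h), min_eq_right (by omega), Nat.div_eq_of_lt h1,
        Nat.div_eq_of_lt h2]
      rfl

/-- For fixed N the pool is polynomial in n, because N^m ≤ (2^m)^N and 2^m ≤ 2n + 1. -/
theorem encSize_oneHotWords_le (N m n : ℕ) (h : m ≤ n.size) :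
    encSize (oneHotWords N m) ≤ (2 * n + 1) ^ N * (N * (2 * n + 1) * 4 + 1 + 1) + 1 := by
  have h1 : 2 ^ m ≤ 2 * n + 1 := (Nat.pow_le_pow_right (by simp) h).trans (two_pow_size_le n)
  refine encSize_list_le ?_ fun w hw => (encSize_bits_le w).trans ?_
  · rw [length_oneHotWords]
    calc N ^ m ≤ (2 ^ N) ^ m := Nat.pow_le_pow_left N.lt_two_pow_self.le m
      _ = (2 ^ m) ^ N := by rw [← pow_mul, ← pow_mul, mul_comm]
      _ ≤ _ := Nat.pow_le_pow_left h1 N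
  · rw [length_of_mem_oneHotWords hw]
    gcongr
    exact m.lt_two_pow_self.le.trans h1

theorem words_size (N : ℕ) {n : X → ℕ} (hn : PolyComp n) :
    PolyComp fun x => (oneHotWords N (n x).size, (n x).size) := by
  have hN : PolyBounded fun x => 2 * n x + 1 := hn.size.mono fun x => by rw [encSize_nat]
  have := iterate (f := fun _ => logStep N) (b := fun x => (n x, [[]], 0)) (n := n) ?_
    (hn.pair (const _)) hn (B := ℕ × List (List Bool) × ℕ)
    ((hN.fst.add ((((hN.pow N).mul ((((PolyBounded.const N).mul hN).mul (.const 4)).add (.const 1)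
      |>.add (.const 1))).add (.const 1)).fst.add ((((PolyBounded.const 2).mul hN).add
      (.const 3)).fst))).mono fun p => ?_)
  · have h (n : ℕ) : min n n.size = n.size :=
      min_eq_right (Nat.size_le.2 n.lt_two_pow_self)
    simpa only [iterate_logStep, h] using this.snd
  · exact ite (natPos id.snd.fst) (pair (natHalf id.snd.fst) (pair (extendWords N id.snd.snd.fst)
      (natAdd id.snd.snd.snd (const 1)))) id.snd
  · rw [iterate_logStep]
    have h1 : min p.2 (n p.1).size ≤ (n p.1).size := min_le_right _ _
    have h2 := encSize_oneHotWords_le N _ _ h1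
    have h3 : n p.1 / 2 ^ p.2 ≤ n p.1 := Nat.div_le_self _ _
    have h4 := (Nat.size (n p.1)).lt_two_pow_self.le.trans (two_pow_size_le (n p.1))
    simp only [encSize_prod, encSize_nat] at *
    omega

theorem kMeansReduction (D N j : ℕ) : PolyComp (kMeansReduction D N j) := by
  have hE : PolyComp fun I : ℕ × ℕ × List (List Bool) => I.2.2 := id.snd.snd
  have hW := words_size N hE.length
  have hd := const_mul N hW.snd
  have hc := greedyCode D hW.snd hW.fst (orAll (replicate id.fst (const false)) hE)
  exact hd.pair (id.snd.fst.pair ((const_mul j hW.snd).pair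
    (map (embedSet (hd.comp id.fst) (hc.comp id.fst) id.snd) hE)))

end PolyComp

/-! ## The code -/

theorem commonOnes_append {b w x : List Bool} (b' : List Bool)
    (h : b.length = b'.length) :
    commonOnes (b ++ w) (b' ++ x) = commonOnes b b' + commonOnes w x := by
  rw [commonOnes, List.zipWith_append h, List.count_append, commonOnes, commonOnes]

theorem commonOnes_ofFn {d : ℕ} (f g : Fin d → Bool) :
    commonOnes (List.ofFn f) (List.ofFn g) = (Finset.univ.filter fun i => f i ∧ g i).card := by
  induction d with
  | zero => simp [commonOnes]
  | succ d ih =>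
    have := ih (fun i => f i.succ) fun i => g i.succ
    rw [commonOnes] at *
    rw [List.ofFn_succ, List.ofFn_succ, List.zipWith_cons_cons, List.count_cons, this,
      Fin.card_filter_univ_succ]
    cases f 0 <;> cases g 0 <;> simp

theorem commonOnes_oneHot {N : ℕ} (i j : Fin N) :
    commonOnes (List.ofFn fun a : Fin N => decide (a = i)) (List.ofFn fun a : Fin N => decide (a = j))
      = if i = j then 1 else 0 := by
  rw [commonOnes_ofFn]
  split_ifs with h
  · subst h
    simp [Finset.filter_eq']
  · rw [Finset.card_eq_zero, Finset.filter_eq_empty_iff]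
    intro a _ ha
    simp at ha
    exact h (ha.1.symm.trans ha.2)

theorem commonOnes_self_of_mem {N m : ℕ} {w : List Bool} (h : w ∈ oneHotWords N m) :
    commonOnes w w = m := by
  induction m generalizing w with
  | zero => simp [oneHotWords] at h; simp [h, commonOnes]
  | succ m ih =>
    obtain ⟨b, hb, v, hv, rfl⟩ := mem_oneHotWords_succ.1 h
    obtain ⟨i, rfl⟩ := List.mem_ofFn.1 hb
    rw [commonOnes_append _ rfl, ih hv, commonOnes_oneHot, if_pos rfl, add_comm]

theorem sum_map_flatMap {α β : Type*} (f : β → ℕ) (g : α → List β) (l : List α) :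
    ((l.flatMap g).map f).sum = (l.map fun a => ((g a).map f).sum).sum := by
  induction l with
  | nil => rfl
  | cons a l ih => simp [ih]

/-- The sum factors over the m blocks: in each block one unit vector agrees with that of w and
contributes t, the other N - 1 contribute 1. -/
theorem sum_pow_commonOnes {N m t : ℕ} {w : List Bool} (h : w ∈ oneHotWords N m) :
    ((oneHotWords N m).map fun x => t ^ commonOnes w x).sum = (N - 1 + t) ^ m := by
  induction m generalizing w with
  | zero => simp [oneHotWords] at h; simp [oneHotWords, commonOnes, h]
  | succ m ih =>
    obtain ⟨b, hb, v, hv, rfl⟩ := mem_oneHotWords_succ.1 h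
    have h1 : ((oneHots N).map fun x => t ^ commonOnes b x).sum = N - 1 + t := by
      obtain ⟨i, rfl⟩ := List.mem_ofFn.1 hb
      simp only [oneHots, List.map_ofFn, List.sum_ofFn, Function.comp_def, commonOnes_oneHot]
      rw [← Finset.add_sum_erase _ _ (Finset.mem_univ i),
        Finset.sum_congr rfl fun x hx => by rw [if_neg (Finset.ne_of_mem_erase hx).symm]]
      simp [Finset.card_erase_of_mem, add_comm]
    rw [oneHotWords, extendWords, sum_map_flatMap, pow_succ, ← ih hv, ← h1,
      ← List.sum_map_mul_right]
    congr 1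
    refine List.map_congr_left fun x _ => ?_
    rw [List.map_map, ← List.sum_map_mul_left]
    congr 1
    refine List.map_congr_left fun c hc => ?_
    rw [Function.comp_apply, commonOnes_append _
      ((length_of_mem_oneHots hb).trans (length_of_mem_oneHots hc).symm), pow_add, mul_comm]

/-- Markov's inequality for N^(common ones) with N = (4z)^D: a discarded word contributes at least
N^(m/D) = (4z)^m, and the total is (2N-1)^m ≤ (2N)^m. One choice thus removes at most (N/2z)^m
words. -/
theorem pow_mul_length_filter_le {z D m : ℕ} (hz : 1 ≤ z) {w : List Bool}
    (h : w ∈ oneHotWords ((4 * z) ^ D) m) {R : List (List Bool)}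
    (hR : R.Sublist (oneHotWords ((4 * z) ^ D) m)) :
    (2 * z) ^ m * (R.filter fun x => !decide (D * commonOnes w x < m)).length
      ≤ ((4 * z) ^ D) ^ m := by
  have h1 : ∀ S : List (List Bool), (∀ x ∈ S, m ≤ D * commonOnes w x) →
      (4 * z) ^ m * S.length ≤ (S.map fun x => ((4 * z) ^ D) ^ commonOnes w x).sum := by
    intro S hS
    induction S with
    | nil => simp
    | cons a S ih =>
      have h2 := ih fun x hx => hS x (by simp [hx])
      have h3 : (4 * z) ^ m ≤ ((4 * z) ^ D) ^ commonOnes w a := by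
        rw [← pow_mul]
        exact Nat.pow_le_pow_right (by omega) (hS a (by simp))
      simp only [List.length_cons, List.map_cons, List.sum_cons, mul_add, mul_one]
      omega
  have h2 := h1 (R.filter fun x => !decide (D * commonOnes w x < m)) fun x hx => by
    simpa using (List.mem_filter.1 hx).2
  have h3 : ((R.filter fun x => !decide (D * commonOnes w x < m)).map
      fun x => ((4 * z) ^ D) ^ commonOnes w x).sum ≤ _ :=
    ((List.filter_sublist.trans hR).map _).sum_le_sum fun _ _ => Nat.zero_le _
  rw [sum_pow_commonOnes h] at h3
  have h4 : ((4 * z) ^ D - 1 + (4 * z) ^ D) ^ m ≤ 2 ^ m * ((4 * z) ^ D) ^ m := by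
    rw [← mul_pow]
    exact Nat.pow_le_pow_left (by omega) m
  have h5 : (4 * z) ^ m = 2 ^ m * (2 * z) ^ m := by rw [← mul_pow]; congr 1; ring
  rw [h5, mul_assoc] at h2
  exact Nat.le_of_mul_le_mul_left (h2.trans (h3.trans h4)) (by positivity)

/-- The greedy procedure does not run out of words. -/
theorem exists_getElem?_greedyCode {z D m : ℕ} (hz : 1 ≤ z) {U : List Bool} {R : List (List Bool)}
    (hR : R.Sublist (oneHotWords ((4 * z) ^ D) m))
    (hU : U.count true * ((4 * z) ^ D) ^ m ≤ (2 * z) ^ m * R.length) {i : ℕ}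
    (hi : U[i]? = some true) : ∃ w ∈ R, (greedyCode D m R U)[i]? = some w := by
  induction U generalizing R i with
  | nil => simp at hi
  | cons b U ih =>
    cases b
    · cases i with
      | zero => simp at hi
      | succ i => exact ih hR (by simpa using hU) (by simpa using hi)
    · rw [List.count_cons_self, add_mul, one_mul] at hU
      cases R with
      | nil =>
        have : 0 < ((4 * z) ^ D) ^ m := by positivity
        simp at hU
        omega
      | cons w R =>
        cases i with
        | zero => exact ⟨w, by simp, rfl⟩
        | succ i =>
          -- The invariant survives a choice: the left side drops by N^m, the right side by at most
          -- N^m.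
          have hU' : U.count true * ((4 * z) ^ D) ^ m ≤ (2 * z) ^ m *
              ((w :: R).filter fun x => decide (D * commonOnes w x < m)).length := by
            have h1 := pow_mul_length_filter_le hz (hR.subset (List.mem_cons_self)) hR
            have h2 := List.length_eq_length_filter_add (l := w :: R)
              fun x => decide (D * commonOnes w x < m)
            rw [h2, mul_add] at hU
            omega
          obtain ⟨x, hx, h⟩ := ih (List.filter_sublist.trans hR) hU' (i := i) (by simpa using hi)
          exact ⟨x, (List.mem_filter.1 hx).1, by simpa [greedyCode] using h⟩

/-- A later word is taken from the pool filtered by the earlier one; that the pool is not exhausted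
rules out the default word `[]`. -/
theorem commonOnes_lt_of_greedyCode {z D m : ℕ} (hz : 1 ≤ z) {U : List Bool}
    {R : List (List Bool)} (hR : R.Sublist (oneHotWords ((4 * z) ^ D) m))
    (hU : U.count true * ((4 * z) ^ D) ^ m ≤ (2 * z) ^ m * R.length) {i j : ℕ} (hij : i < j)
    (hi : U[i]? = some true) (hj : U[j]? = some true) {w x : List Bool}
    (hw : (greedyCode D m R U)[i]? = some w) (hx : (greedyCode D m R U)[j]? = some x) :
    D * commonOnes w x < m := by
  induction U generalizing R i j with
  | nil => simp at hi
  | cons b U ih =>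
    obtain ⟨j, rfl⟩ : ∃ j', j = j' + 1 := ⟨j - 1, by omega⟩
    cases b
    · cases i with
      | zero => simp at hi
      | succ i =>
        exact ih (i := i) (j := j) hR (by simpa using hU) (Nat.lt_of_succ_lt_succ hij) (by simpa using hi) (by simpa using hj)
          (by simpa [greedyCode] using hw) (by simpa [greedyCode] using hx)
    · rw [List.count_cons_self, add_mul, one_mul] at hU
      cases R with
      | nil =>
        have : 0 < ((4 * z) ^ D) ^ m := by positivity
        simp at hU
        omega
      | cons v R =>
        have hR' := (List.filter_sublist (l := v :: R)
          (p := fun x => decide (D * commonOnes v x < m))).trans hR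
        have hU' : U.count true * ((4 * z) ^ D) ^ m ≤ (2 * z) ^ m *
            ((v :: R).filter fun x => decide (D * commonOnes v x < m)).length := by
          have h1 := pow_mul_length_filter_le hz (hR.subset (List.mem_cons_self)) hR
          have h2 := List.length_eq_length_filter_add (l := v :: R)
            fun x => decide (D * commonOnes v x < m)
          rw [h2, mul_add] at hU
          omega
        cases i with
        | zero =>
          obtain ⟨x', hx', h⟩ := exists_getElem?_greedyCode hz hR' hU' (i := j) (by simpa using hj)
          simp only [greedyCode, List.headD_cons, List.getElem?_cons_zero,
            Option.some.injEq] at hw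
          simp only [greedyCode, List.headD_cons, List.getElem?_cons_succ] at hx
          obtain rfl := Option.some.inj (hx.symm.trans h)
          subst hw
          simpa using (List.mem_filter.1 hx').2
        | succ i =>
          exact ih (i := i) (j := j) hR' hU' (Nat.lt_of_succ_lt_succ hij) (by simpa using hi) (by simpa using hj)
            (by simpa [greedyCode] using hw) (by simpa [greedyCode] using hx)

/-! ### Disjunctions -/

theorem length_orAll {w : List Bool} {l : List (List Bool)} (h : ∀ x ∈ l, x.length = w.length) :
    (orAll w l).length = w.length := by
  induction l generalizing w with
  | nil => rfl
  | cons a l ih =>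
    have h1 := h a (by simp)
    have h2 : (List.zipWith (fun c d => c || d) w a).length = w.length := by simp [h1]
    exact (ih fun x hx => (h x (by simp [hx])).trans h2.symm).trans h2

/-- Equal lengths matter, since `zipWith` truncates to the shorter word. -/
theorem getD_orAll {w : List Bool} {l : List (List Bool)} (h : ∀ x ∈ l, x.length = w.length)
    (i : ℕ) : (orAll w l).getD i false = true ↔
      w.getD i false = true ∨ ∃ x ∈ l, x.getD i false = true := by
  induction l generalizing w with
  | nil => simp [orAll]
  | cons a l ih =>
    have h1 := h a (by simp)
    have h2 : (List.zipWith (fun c d => c || d) w a).length = w.length := by simp [h1]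
    have h3 : (List.zipWith (fun c d => c || d) w a).getD i false =
        (w.getD i false || a.getD i false) := by
      by_cases hi : i < w.length
      · simp [List.getD_eq_getElem?_getD, hi, h1]
      · have h4 : w[i]? = none := by simp; omega
        have h5 : a[i]? = none := by simp; omega
        simp [List.getD_eq_getElem?_getD, List.getElem?_zipWith, h4, h5]
    have := ih (w := List.zipWith (fun c d => c || d) w a)
      fun x hx => (h x (by simp [hx])).trans h2.symm
    rw [h3] at this
    change (orAll _ l).getD i false = true ↔ _
    rw [this]
    simp [or_assoc]

theorem count_zipWith_or_le (w x : List Bool) :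
    (List.zipWith (fun c d => c || d) w x).count true ≤ w.count true + x.count true := by
  induction w generalizing x with
  | nil => simp
  | cons a w ih =>
    cases x with
    | nil => simp
    | cons b x =>
      have := ih x
      cases a <;> cases b <;> simp <;> omega

theorem count_orAll_le {w : List Bool} {l : List (List Bool)} {z : ℕ}
    (h : ∀ x ∈ l, x.count true ≤ z) :
    (orAll w l).count true ≤ w.count true + l.length * z := by
  induction l generalizing w with
  | nil => simp [orAll]
  | cons a l ih =>
    have h1 := ih (w := List.zipWith (fun c d => c || d) w a) fun x hx => h x (by simp [hx])
    have h2 := count_zipWith_or_le w a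
    have h3 := h a (by simp)
    change (orAll (List.zipWith (fun c d => c || d) w a) l).count true ≤ _
    rw [List.length_cons, add_mul]
    omega

/-! ## Intersecting families of sets -/

section Families

variable {n : ℕ}

/-- A superset T of S is determined by T \ S, which has z - |S| elements. -/
theorem card_filter_superset_le (E : Finset (Finset (Fin n))) {z : ℕ} (hE : ∀ T ∈ E, T.card = z)
    (S : Finset (Fin n)) : (E.filter fun T => S ⊆ T).card ≤ n ^ (z - S.card) := by
  have h1 : (E.filter fun T => S ⊆ T).card ≤
      (Finset.powersetCard (z - S.card) (Finset.univ : Finset (Fin n))).card := by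
    refine Finset.card_le_card_of_injOn (fun T => T \ S) ?_ ?_
    · intro T hT
      obtain ⟨h2, h3⟩ := Finset.mem_filter.1 hT
      refine Finset.mem_coe.2 (Finset.mem_powersetCard.2 ⟨Finset.subset_univ _, ?_⟩)
      rw [Finset.card_sdiff_of_subset h3, hE T h2]
    · intro T hT T' hT' h
      have h3 := (Finset.mem_filter.1 hT).2
      have h3' := (Finset.mem_filter.1 hT').2
      rw [← Finset.sdiff_union_of_subset h3, ← Finset.sdiff_union_of_subset h3']
      exact congrArg (· ∪ S) h
  rw [Finset.card_powersetCard, Finset.card_univ, Fintype.card_fin] at h1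
  exact h1.trans (Nat.choose_le_pow _ _)

/-- Sets of size `z` that pairwise share `s` elements are few. -/
theorem card_le_of_intersecting {F : Finset (Finset (Fin n))} {z s : ℕ}
    (hF : ∀ T ∈ F, T.card = z) (h : ∀ T ∈ F, ∀ T' ∈ F, s ≤ (T ∩ T').card) :
    F.card ≤ 2 ^ z * n ^ (z - s) := by
  rcases F.eq_empty_or_nonempty with rfl | ⟨T₀, h₀⟩
  · simp
  -- Every member contains an s-subset of the fixed member T₀, and T₀ has at most 2^z subsets.
  have h1 : F ⊆ (T₀.powersetCard s).biUnion fun S => F.filter fun T => S ⊆ T := by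
    intro T hT
    obtain ⟨S, hS, hc⟩ := Finset.exists_subset_card_eq (h T hT T₀ h₀)
    exact Finset.mem_biUnion.2 ⟨S, Finset.mem_powersetCard.2
      ⟨hS.trans Finset.inter_subset_right, hc⟩,
      Finset.mem_filter.2 ⟨hT, hS.trans Finset.inter_subset_left⟩⟩
  refine (Finset.card_le_card h1).trans ((Finset.card_biUnion_le_card_mul _ _ (n ^ (z - s))
    fun S hS => ?_).trans (Nat.mul_le_mul_right _ ?_))
  · rw [← (Finset.mem_powersetCard.1 hS).2]
    exact card_filter_superset_le F hF S
  · rw [Finset.card_powersetCard, hF T₀ h₀]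
    exact Nat.choose_le_two_pow _ _

/-- Sets of size `z` that pairwise share `y` elements have `y` elements in common, or there are
few of them. -/
theorem exists_subset_or_card_le {F : Finset (Finset (Fin n))} {z y : ℕ}
    (hF : ∀ T ∈ F, T.card = z) (h : ∀ T ∈ F, ∀ T' ∈ F, y ≤ (T ∩ T').card) (hne : F.Nonempty) :
    (∃ S : Finset (Fin n), S.card = y ∧ ∀ T ∈ F, S ⊆ T) ∨
      F.card ≤ 2 ^ z * z * n ^ (z - y - 1) := by
  by_contra! hc
  obtain ⟨hc, hlt⟩ := hc
  -- For each y-set S, `T' S` is a member that does not contain S.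
  choose! T' hT' hS using hc
  obtain ⟨T₀, h₀⟩ := hne
  have h1 : F ⊆ (T₀.powersetCard y).biUnion fun S => (T' S \ S).biUnion fun u =>
      F.filter fun T => insert u S ⊆ T := by
    intro T hT
    obtain ⟨S, hST, hc⟩ := Finset.exists_subset_card_eq (h T hT T₀ h₀)
    -- T meets `T' S` in at least y elements, and these cannot all lie in S, for then S would be
    -- contained in `T' S`. So T contains S and one of at most z further elements: a gain of one in
    -- the exponent of n.
    obtain ⟨u, hu, huS⟩ : ∃ u ∈ T ∩ T' S, u ∉ S := by
      by_contra! hall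
      have h2 : T ∩ T' S = S :=
        Finset.eq_of_subset_of_card_le hall (hc ▸ h T hT _ (hT' S hc))
      exact hS S hc (h2.symm.subset.trans Finset.inter_subset_right)
    rw [Finset.mem_inter] at hu
    refine Finset.mem_biUnion.2 ⟨S, Finset.mem_powersetCard.2
      ⟨hST.trans Finset.inter_subset_right, hc⟩, Finset.mem_biUnion.2 ⟨u,
      Finset.mem_sdiff.2 ⟨hu.2, huS⟩, Finset.mem_filter.2 ⟨hT, ?_⟩⟩⟩
    exact Finset.insert_subset hu.1 (hST.trans Finset.inter_subset_left)
  refine absurd (Finset.card_le_card h1) (not_le.2 (lt_of_le_of_lt ?_ hlt))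
  rw [mul_assoc]
  refine (Finset.card_biUnion_le_card_mul _ _ (z * n ^ (z - y - 1))
    fun S hS => ?_).trans (Nat.mul_le_mul_right _ ?_)
  · have hc := (Finset.mem_powersetCard.1 hS).2
    refine (Finset.card_biUnion_le_card_mul _ _ (n ^ (z - y - 1)) fun u hu => ?_).trans
      (Nat.mul_le_mul_right _ ?_)
    · have h2 := card_filter_superset_le F hF (insert u S)
      rwa [Finset.card_insert_of_notMem (Finset.mem_sdiff.1 hu).2, hc, ← Nat.sub_sub] at h2
    · exact (Finset.card_le_card Finset.sdiff_subset).trans (hF _ (hT' S hc)).le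
  · rw [Finset.card_powersetCard, hF T₀ h₀]
    exact Nat.choose_le_two_pow _ _

end Families

/-! ## Geometry of the embedding -/

theorem l1Dist_triangle {d : ℕ} (a b c : Fin d → ℝ) : l1Dist a b ≤ l1Dist a c + l1Dist b c := by
  rw [l1Dist, l1Dist, l1Dist, ← Finset.sum_add_distrib]
  refine Finset.sum_le_sum fun i _ => ?_
  rw [abs_sub_comm (b i)]
  exact abs_sub_le _ _ _

theorem l1Dist_nonneg {d : ℕ} (a b : Fin d → ℝ) : 0 ≤ l1Dist a b :=
  Finset.sum_nonneg fun _ _ => abs_nonneg _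

/-- The bit vector of a set. -/
def bitsOfSet {d : ℕ} (V : Finset (Fin d)) : Fin d → Bool := fun i => decide (i ∈ V)

theorem l1Dist_bitsOfSet {d : ℕ} (V V' : Finset (Fin d)) :
    l1Dist (KMeansInstance.toReal (bitsOfSet V)) (KMeansInstance.toReal (bitsOfSet V')) =
      (V \ V').card + (V' \ V).card := by
  rw [← Nat.cast_add, ← Finset.card_union_of_disjoint (disjoint_sdiff_sdiff), Finset.card_eq_sum_ones,
    Nat.cast_sum, l1Dist, ← Finset.sum_subset (Finset.subset_univ (V \ V' ∪ V' \ V))]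
  · refine Finset.sum_congr rfl fun i hi => ?_
    simp only [Finset.mem_union, Finset.mem_sdiff] at hi
    rcases hi with hi | hi <;> simp [KMeansInstance.toReal, bitsOfSet, hi]
  · intro i _ hi
    simp only [Finset.mem_union, Finset.mem_sdiff] at hi
    by_cases h1 : i ∈ V <;> by_cases h2 : i ∈ V' <;>
      simp_all [KMeansInstance.toReal, bitsOfSet]

/-- Nearly disjoint code words of weight `m` for the elements of the sets in `E`. -/
structure IsSetCode {n d : ℕ} (E : Finset (Finset (Fin n))) (A : Fin n → Finset (Fin d))
    (m D : ℕ) : Prop where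
  card_eq : ∀ T ∈ E, ∀ u ∈ T, (A u).card = m
  card_inter : ∀ T ∈ E, ∀ T' ∈ E, ∀ u ∈ T, ∀ v ∈ T', u ≠ v → D * (A u ∩ A v).card ≤ m

namespace IsSetCode

variable {n d : ℕ} {E : Finset (Finset (Fin n))} {A : Fin n → Finset (Fin d)} {m D z : ℕ}

/-- Each u in T \ T' keeps the private part `B u` of its word, outside the words of all other
elements of T ∪ T'. These parts are disjoint, and since there are at most 2z other words, each part
loses at most 2z·m/D ones. -/
theorem mul_card_sdiff_le (hA : IsSetCode E A m D) (hE : ∀ T ∈ E, T.card = z)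
    {T T' : Finset (Fin n)} (hT : T ∈ E) (hT' : T' ∈ E) :
    (T \ T').card * (D * m) ≤ D * (T.biUnion A \ T'.biUnion A).card + (T \ T').card * (2 * z * m) := by
  let B : Fin n → Finset (Fin d) := fun u => A u \ ((T ∪ T').erase u).biUnion A
  have h1 : (T \ T').biUnion B ⊆ T.biUnion A \ T'.biUnion A := by
    intro p hp
    obtain ⟨u, hu, hp⟩ := Finset.mem_biUnion.1 hp
    obtain ⟨hu, hu'⟩ := Finset.mem_sdiff.1 hu
    obtain ⟨hp, hp'⟩ := Finset.mem_sdiff.1 hp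
    refine Finset.mem_sdiff.2 ⟨Finset.mem_biUnion.2 ⟨u, hu, hp⟩, fun h => hp' ?_⟩
    obtain ⟨v, hv, hpv⟩ := Finset.mem_biUnion.1 h
    exact Finset.mem_biUnion.2 ⟨v, Finset.mem_erase.2
      ⟨fun h => hu' (h ▸ hv), Finset.mem_union_right _ hv⟩, hpv⟩
  have h2 : ((T \ T').biUnion B).card = ∑ u ∈ T \ T', (B u).card := by
    refine Finset.card_biUnion fun u hu v hv huv => Finset.disjoint_left.2 fun p hp hp' => ?_
    refine (Finset.mem_sdiff.1 hp).2 (Finset.mem_biUnion.2 ⟨v, Finset.mem_erase.2 ⟨huv.symm,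
      Finset.mem_union_left _ (Finset.mem_sdiff.1 hv).1⟩, (Finset.mem_sdiff.1 hp').1⟩)
  have h3 : ∀ u ∈ T \ T', D * m ≤ D * (B u).card + 2 * z * m := by
    intro u hu
    have huT := (Finset.mem_sdiff.1 hu).1
    have h4 : A u ⊆ B u ∪ ((T ∪ T').erase u).biUnion fun v => A u ∩ A v := by
      intro p hp
      by_cases h : p ∈ ((T ∪ T').erase u).biUnion A
      · obtain ⟨v, hv, hpv⟩ := Finset.mem_biUnion.1 h
        exact Finset.mem_union_right _ (Finset.mem_biUnion.2 ⟨v, hv, Finset.mem_inter.2 ⟨hp, hpv⟩⟩)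
      · exact Finset.mem_union_left _ (Finset.mem_sdiff.2 ⟨hp, h⟩)
    have h5 := (Finset.card_le_card h4).trans ((Finset.card_union_le _ _).trans
      (Nat.add_le_add_left Finset.card_biUnion_le _))
    rw [hA.card_eq T hT u huT] at h5
    have h6 : D * ∑ v ∈ (T ∪ T').erase u, (A u ∩ A v).card ≤ 2 * z * m := by
      rw [Finset.mul_sum]
      refine (Finset.sum_le_card_nsmul _ _ m fun v hv => ?_).trans ?_
      · obtain ⟨hvu, hv⟩ := Finset.mem_erase.1 hv
        rcases Finset.mem_union.1 hv with hv | hv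
        · exact hA.card_inter T hT T hT u huT v hv hvu.symm
        · exact hA.card_inter T hT T' hT' u huT v hv hvu.symm
      · rw [smul_eq_mul]
        refine Nat.mul_le_mul_right _ ((Finset.card_le_card (Finset.erase_subset _ _)).trans
          ((Finset.card_union_le _ _).trans ?_))
        rw [hE T hT, hE T' hT', two_mul]
    have h7 := Nat.mul_le_mul_left D h5
    rw [mul_add] at h7
    omega
  have h4 := Finset.card_le_card h1
  rw [h2] at h4
  have h5 := Finset.sum_le_sum h3
  rw [Finset.sum_add_distrib, Finset.sum_const, Finset.sum_const, smul_eq_mul, smul_eq_mul,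
    ← Finset.mul_sum] at h5
  have h6 := Nat.mul_le_mul_left D h4
  omega

/-- The point of a set. -/
def point (A : Fin n → Finset (Fin d)) (T : Finset (Fin n)) : Fin d → Bool :=
  bitsOfSet (T.biUnion A)

theorem le_l1Dist (hA : IsSetCode E A m D) (hD : 0 < D) (hE : ∀ T ∈ E, T.card = z)
    {T T' : Finset (Fin n)} (hT : T ∈ E) (hT' : T' ∈ E) :
    2 * ((z : ℝ) - (T ∩ T').card) * (m * (1 - 2 * z / D)) ≤
      l1Dist (KMeansInstance.toReal (point A T)) (KMeansInstance.toReal (point A T')) := by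
  have key : ∀ {T T' : Finset (Fin n)}, T ∈ E → T' ∈ E →
      ((z : ℝ) - (T ∩ T').card) * (m * (1 - 2 * z / D)) ≤ (T.biUnion A \ T'.biUnion A).card := by
    intro T T' hT hT'
    have h1 := hA.mul_card_sdiff_le hE hT hT'
    have h2 : ((T \ T').card : ℝ) = z - (T ∩ T').card := by
      rw [eq_sub_iff_add_eq, ← hE T hT]
      exact_mod_cast Finset.card_sdiff_add_card_inter T T'
    have hD' : (0 : ℝ) < D := by exact_mod_cast hD
    have h3 : ((T \ T').card : ℝ) * (D * m) ≤ D * (T.biUnion A \ T'.biUnion A).card +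
        (T \ T').card * (2 * z * m) := by exact_mod_cast h1
    rw [h2] at h3
    refine le_of_mul_le_mul_left ?_ hD'
    have h4 : (D : ℝ) * (((z : ℝ) - (T ∩ T').card) * (m * (1 - 2 * z / D))) =
        (z - (T ∩ T').card) * (D * m) - (z - (T ∩ T').card) * (2 * z * m) := by
      field_simp
    rw [h4]
    linarith
  have h1 := key hT hT'
  have h2 := key hT' hT
  rw [Finset.inter_comm] at h2
  rw [point, point, l1Dist_bitsOfSet]
  linarith

/-- The point of S lies below that of T, and the excess ones are covered by the z - |S| words of T \
S. No near-disjointness is needed. -/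
theorem l1Dist_le (hA : IsSetCode E A m D) (hE : ∀ T ∈ E, T.card = z) {S T : Finset (Fin n)}
    (hT : T ∈ E) (hS : S ⊆ T) :
    l1Dist (KMeansInstance.toReal (point A T)) (KMeansInstance.toReal (point A S)) ≤
      ((z - S.card) * m : ℕ) := by
  have h1 : S.biUnion A ⊆ T.biUnion A := Finset.biUnion_subset_biUnion_of_subset_left A hS
  have h2 : T.biUnion A \ S.biUnion A ⊆ (T \ S).biUnion A := by
    intro p hp
    obtain ⟨hp, hp'⟩ := Finset.mem_sdiff.1 hp
    obtain ⟨u, hu, hpu⟩ := Finset.mem_biUnion.1 hp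
    exact Finset.mem_biUnion.2 ⟨u, Finset.mem_sdiff.2 ⟨hu, fun h => hp' (Finset.mem_biUnion.2
      ⟨u, h, hpu⟩)⟩, hpu⟩
  rw [point, point, l1Dist_bitsOfSet, Finset.sdiff_eq_empty_iff_subset.2 h1, Finset.card_empty,
    Nat.cast_zero, add_zero, Nat.cast_le, ← hE T hT, ← Finset.card_sdiff_of_subset hS]
  exact (Finset.card_le_card h2).trans (Finset.card_biUnion_le_card_mul _ _ _ fun u hu =>
    (hA.card_eq T hT u (Finset.mem_sdiff.1 hu).1).le)

end IsSetCode

/-! ## Completeness and soundness -/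

theorem one_sub_two_mul_div_pos {z D : ℕ} (h : 2 * z < D) : (0 : ℝ) < 1 - 2 * z / D := by
  have hD : (0 : ℝ) < D := by exact_mod_cast (Nat.zero_le _).trans_lt h
  rw [sub_pos, div_lt_one hD]
  exact_mod_cast h

namespace IsSetCode

variable {n d : ℕ} {E : Finset (Finset (Fin n))} {A : Fin n → Finset (Fin d)} {m D z y : ℕ}

theorem le_card_inter (hA : IsSetCode E A m D) (hD : 2 * z < D) (hE : ∀ T ∈ E, T.card = z)
    (hm : 0 < m) {T T' : Finset (Fin n)} (hT : T ∈ E) (hT' : T' ∈ E) {c : Fin d → ℝ} {s : ℕ}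
    (h : l1Dist (KMeansInstance.toReal (point A T)) c < ((z : ℝ) - s) * (m * (1 - 2 * z / D)))
    (h' : l1Dist (KMeansInstance.toReal (point A T')) c < ((z : ℝ) - s) * (m * (1 - 2 * z / D))) :
    s + 1 ≤ (T ∩ T').card := by
  have hθ : (0 : ℝ) < m * (1 - 2 * z / D) :=
    mul_pos (Nat.cast_pos.2 hm) (one_sub_two_mul_div_pos hD)
  have h1 := hA.le_l1Dist ((Nat.zero_le _).trans_lt hD) hE hT hT'
  have h2 := l1Dist_triangle (KMeansInstance.toReal (point A T))
    (KMeansInstance.toReal (point A T')) c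
  have h3 : ((z : ℝ) - (T ∩ T').card) * (m * (1 - 2 * z / D)) <
    (z - s) * (m * (1 - 2 * z / D)) := by linarith
  have h4 := lt_of_mul_lt_mul_right h3 hθ.le
  have h5 : (s : ℝ) < (T ∩ T').card := by linarith
  exact_mod_cast h5

/-- Distance zero forces an intersection of full size z. This makes the number of points equal to
|E|, the normalization of the cost. -/
theorem point_injOn (hA : IsSetCode E A m D) (hD : 2 * z < D) (hE : ∀ T ∈ E, T.card = z)
    (hm : 0 < m) : Set.InjOn (point A) E := by
  intro T hT T' hT' h
  have hθ : (0 : ℝ) < m * (1 - 2 * z / D) :=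
    mul_pos (Nat.cast_pos.2 hm) (one_sub_two_mul_div_pos hD)
  have h1 := hA.le_l1Dist ((Nat.zero_le _).trans_lt hD) hE hT hT'
  have h0 : l1Dist (KMeansInstance.toReal (point A T')) (KMeansInstance.toReal (point A T')) = 0 := by
    simp [l1Dist]
  rw [h, h0, mul_assoc] at h1
  have h2 : ((z : ℝ) - (T ∩ T').card) ≤ 0 :=
    nonpos_of_mul_nonpos_left (by linarith) hθ
  have h3 : z ≤ (T ∩ T').card := by
    have : (z : ℝ) ≤ (T ∩ T').card := by linarith
    exact_mod_cast this
  have h4 := Finset.eq_of_subset_of_card_le Finset.inter_subset_left (by rwa [hE T hT])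
  have h5 := Finset.eq_of_subset_of_card_le Finset.inter_subset_right (by rwa [hE T' hT'])
  exact h4.symm.trans h5

/-- Few points are very close to their centers. -/
theorem card_veryNear_le (hA : IsSetCode E A m D) (hD : 2 * z < D) (hE : ∀ T ∈ E, T.card = z)
    (hm : 0 < m) {k : ℕ} (c : Fin k → Fin d → ℝ) (σ : Finset (Fin n) → Fin k) :
    (E.filter fun T => l1Dist (KMeansInstance.toReal (point A T)) (c (σ T)) <
      ((z : ℝ) - y) * (m * (1 - 2 * z / D))).card ≤ k * (2 ^ z * n ^ (z - y - 1)) := by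
  set F := E.filter fun T => l1Dist (KMeansInstance.toReal (point A T)) (c (σ T)) <
    ((z : ℝ) - y) * (m * (1 - 2 * z / D)) with hF
  have h1 : F ⊆ (Finset.univ : Finset (Fin k)).biUnion fun j => F.filter fun T => σ T = j :=
    fun T hT => Finset.mem_biUnion.2 ⟨σ T, Finset.mem_univ _, Finset.mem_filter.2 ⟨hT, rfl⟩⟩
  refine (Finset.card_le_card h1).trans ((Finset.card_biUnion_le_card_mul _ _ _ fun j _ =>
    card_le_of_intersecting (z := z) (s := y + 1) (fun T hT => hE T
      (Finset.mem_filter.1 (Finset.mem_filter.1 hT).1).1) fun T hT T' hT' => ?_).trans ?_)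
  · obtain ⟨hT, h2⟩ := Finset.mem_filter.1 hT
    obtain ⟨hT', h2'⟩ := Finset.mem_filter.1 hT'
    obtain ⟨hT, h3⟩ := Finset.mem_filter.1 hT
    obtain ⟨hT', h3'⟩ := Finset.mem_filter.1 hT'
    rw [h2] at h3
    rw [h2'] at h3'
    exact hA.le_card_inter hD hE hm hT hT' h3 h3'
  · rw [Finset.card_univ, Fintype.card_fin, ← Nat.sub_sub]

/-- Most points that are close to their centers belong to sets that are covered by few sets of
size `y`. -/
theorem exists_card_near_le (hA : IsSetCode E A m D) (hD : 2 * z < D) (hE : ∀ T ∈ E, T.card = z)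
    (hm : 0 < m) (hy : 1 ≤ y) (hyn : y ≤ n) {k : ℕ} (c : Fin k → Fin d → ℝ)
    (σ : Finset (Fin n) → Fin k) :
    ∃ S : Fin k → Finset (Fin n), (∀ j, (S j).card = y) ∧
    (E.filter fun T => l1Dist (KMeansInstance.toReal (point A T)) (c (σ T)) <
      ((z : ℝ) - y + 1) * (m * (1 - 2 * z / D))).card ≤
        (JCInstance.covAll ⟨n, E, k⟩ S).card + k * (2 ^ z * z * n ^ (z - y - 1)) := by
  set F := E.filter fun T => l1Dist (KMeansInstance.toReal (point A T)) (c (σ T)) <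
    ((z : ℝ) - y + 1) * (m * (1 - 2 * z / D)) with hF
  have h1 : ∀ j : Fin k, ∃ S : Finset (Fin n), S.card = y ∧
      ((∀ T ∈ F.filter fun T => σ T = j, S ⊆ T) ∨
        (F.filter fun T => σ T = j).card ≤ 2 ^ z * z * n ^ (z - y - 1)) := by
    intro j
    obtain ⟨S₀, hS₀⟩ : ∃ S : Finset (Fin n), S.card = y := by
      obtain ⟨S, _, hS⟩ := Finset.exists_subset_card_eq
        (show y ≤ (Finset.univ : Finset (Fin n)).card by simpa using hyn)
      exact ⟨S, hS⟩
    rcases (F.filter fun T => σ T = j).eq_empty_or_nonempty with h | h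
    · exact ⟨S₀, hS₀, Or.inr (by simp [h])⟩
    have hint : ∀ T ∈ F.filter fun T => σ T = j, ∀ T' ∈ F.filter fun T => σ T = j,
        y ≤ (T ∩ T').card := by
      intro T hT T' hT'
      obtain ⟨hT, h2⟩ := Finset.mem_filter.1 hT
      obtain ⟨hT', h2'⟩ := Finset.mem_filter.1 hT'
      obtain ⟨hT, h3⟩ := Finset.mem_filter.1 hT
      obtain ⟨hT', h3'⟩ := Finset.mem_filter.1 hT'
      rw [h2] at h3
      rw [h2'] at h3'
      -- The threshold is that of `le_card_inter` for s = y - 1, which is where y ≥ 1 is needed.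
      have h4 : (z : ℝ) - y + 1 = z - (y - 1 : ℕ) := by
        rw [Nat.cast_sub hy]; push_cast; ring
      rw [h4] at h3 h3'
      have := hA.le_card_inter hD hE hm hT hT' h3 h3'
      omega
    rcases exists_subset_or_card_le (z := z) (fun T hT => hE T
      (Finset.mem_filter.1 (Finset.mem_filter.1 hT).1).1) hint h with ⟨S, hS, h⟩ | h
    · exact ⟨S, hS, Or.inl h⟩
    · exact ⟨S₀, hS₀, Or.inr h⟩
  choose S hS h using h1
  refine ⟨S, hS, ?_⟩
  have h2 : F ⊆ JCInstance.covAll ⟨n, E, k⟩ S ∪ (Finset.univ : Finset (Fin k)).biUnion fun j =>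
      if (F.filter fun T => σ T = j).card ≤ 2 ^ z * z * n ^ (z - y - 1) then
        F.filter fun T => σ T = j else ∅ := by
    intro T hT
    have hTj : T ∈ F.filter fun T' => σ T' = σ T := Finset.mem_filter.2 ⟨hT, rfl⟩
    rcases h (σ T) with h | h
    · exact Finset.mem_union_left _ (Finset.mem_biUnion.2 ⟨σ T, Finset.mem_univ _,
        Finset.mem_filter.2 ⟨(Finset.mem_filter.1 hT).1, h T hTj⟩⟩)
    · refine Finset.mem_union_right _ (Finset.mem_biUnion.2 ⟨σ T, Finset.mem_univ _, ?_⟩)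
      rwa [if_pos h]
  refine (Finset.card_le_card h2).trans ((Finset.card_union_le _ _).trans
    (Nat.add_le_add_left ?_ _))
  refine (Finset.card_biUnion_le_card_mul _ _ (2 ^ z * z * n ^ (z - y - 1)) fun j _ => ?_).trans ?_
  · split_ifs with h3
    · exact h3
    · simp
  · rw [Finset.card_univ, Fintype.card_fin]

/-- With g = z - y, each point pays g² unless it is very near, and a further (g+1)² - g² unless it
is near, in units of (mθ)². Both exceptional counts are bounded, and 1 + (1-α)(ρ-1) = α + (1-α)ρ for
ρ = (g+1)²/g². The two errors add up to ρ·2^z·z/B relative to g². -/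
theorem le_sum_sq (hA : IsSetCode E A m D) (hD : 2 * z < D) (hE : ∀ T ∈ E, T.card = z)
    (hm : 0 < m) (hy : 1 ≤ y) (hyz : y < z) (hne : E.Nonempty) {k B : ℕ} {α : ℝ}
    (hB : 0 < B)
    (hdense : JCInstance.Dense ⟨n, E, k⟩ z y B) (hsound : JCInstance.Sound ⟨n, E, k⟩ α y)
    (c : Fin k → Fin d → ℝ) (σ : Finset (Fin n) → Fin k) :
    (1 - 2 * z / D : ℝ) ^ 2 * (α + (1 - α) * (((z : ℝ) - y + 1) ^ 2 / ((z : ℝ) - y) ^ 2) -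
      (((z : ℝ) - y + 1) ^ 2 / ((z : ℝ) - y) ^ 2) * (2 ^ z * z / B)) *
      ((((z - y) * m : ℕ) : ℝ) ^ 2 * E.card) ≤
      ∑ T ∈ E, l1Dist (KMeansInstance.toReal (point A T)) (c (σ T)) ^ 2 := by
  obtain ⟨T₀, h₀⟩ := hne
  have hzn : z ≤ n := by
    rw [← hE T₀ h₀]
    exact (Finset.card_le_univ T₀).trans (by simp)
  have h1 := hA.card_veryNear_le (y := y) hD hE hm c σ
  obtain ⟨S, hS, h2⟩ := hA.exists_card_near_le hD hE hm hy (hyz.le.trans hzn) c σ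
  have h3 := hsound S hS
  change ((JCInstance.covAll ⟨n, E, k⟩ S).card : ℝ) ≤ α * E.card at h3
  change B * (k * n ^ (z - y - 1)) ≤ E.card at hdense
  have hB' : (0 : ℝ) < B := by exact_mod_cast hB
  have hθ : (0 : ℝ) < 1 - 2 * z / D := one_sub_two_mul_div_pos hD
  have hzy : (0 : ℝ) < (z : ℝ) - y := by
    have : (y : ℝ) < z := by exact_mod_cast hyz
    linarith
  have hm' : (0 : ℝ) < m := by exact_mod_cast hm
  set θ : ℝ := 1 - 2 * z / D with hθ'
  set g : ℝ := (z : ℝ) - y with hg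
  set e : ℝ := 2 ^ z * z / B * E.card with he
  -- Density is used only here: the exceptional sets of all k centers form a small fraction of `E`.
  have hke : ((k * (2 ^ z * z * n ^ (z - y - 1)) : ℕ) : ℝ) ≤ e := by
    have h4 : (B : ℝ) * (k * n ^ (z - y - 1)) ≤ E.card := by exact_mod_cast hdense
    rw [he, div_mul_eq_mul_div, le_div_iff₀ hB']
    push_cast
    calc (k : ℝ) * (2 ^ z * z * n ^ (z - y - 1)) * B
        = 2 ^ z * z * (B * (k * n ^ (z - y - 1))) := by ring
      _ ≤ _ := by gcongr
  have h1' : ((E.filter fun T => l1Dist (KMeansInstance.toReal (point A T)) (c (σ T)) <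
      g * (m * θ)).card : ℝ) ≤ e := by
    refine (Nat.cast_le.2 (h1.trans (Nat.mul_le_mul_left _ (Nat.mul_le_mul_right _ ?_)))).trans hke
    exact Nat.le_mul_of_pos_right _ (by omega)
  have h2' : ((E.filter fun T => l1Dist (KMeansInstance.toReal (point A T)) (c (σ T)) <
      (g + 1) * (m * θ)).card : ℝ) ≤ α * E.card + e := by
    refine (Nat.cast_le.2 h2).trans ?_
    rw [Nat.cast_add]
    exact add_le_add h3 hke
  have hpt : ∀ T ∈ E, (m * θ) ^ 2 * (g ^ 2 * (1 - if l1Dist (KMeansInstance.toReal (point A T))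
      (c (σ T)) < g * (m * θ) then 1 else 0) + ((g + 1) ^ 2 - g ^ 2) *
      (1 - if l1Dist (KMeansInstance.toReal (point A T)) (c (σ T)) < (g + 1) * (m * θ)
        then 1 else 0)) ≤ l1Dist (KMeansInstance.toReal (point A T)) (c (σ T)) ^ 2 := by
    intro T _
    have hmθ : 0 < m * θ := mul_pos hm' hθ
    have hx := l1Dist_nonneg (KMeansInstance.toReal (point A T)) (c (σ T))
    generalize l1Dist (KMeansInstance.toReal (point A T)) (c (σ T)) = x at *
    have h4 : g * (m * θ) ≤ (g + 1) * (m * θ) := by gcongr; linarith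
    split_ifs with h5 h6 h6
    · simpa using sq_nonneg x
    · exact absurd (h5.trans_le h4) h6
    · rw [not_lt] at h5
      have := pow_le_pow_left₀ (by positivity) h5 2
      linarith
    · rw [not_lt] at h6
      have := pow_le_pow_left₀ (by positivity) h6 2
      linarith
  refine le_trans ?_ (Finset.sum_le_sum hpt)
  have hcard : ∀ p : Finset (Fin n) → Prop, ∀ [DecidablePred p],
      ∑ T ∈ E, (1 - if p T then (1 : ℝ) else 0) = E.card - (E.filter p).card := by
    intro p _
    rw [Finset.sum_sub_distrib, Finset.sum_const, ← Finset.sum_filter, Finset.sum_const]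
    simp
  rw [← Finset.mul_sum, Finset.sum_add_distrib, ← Finset.mul_sum, ← Finset.mul_sum, hcard, hcard]
  have hgg : (((z - y) * m : ℕ) : ℝ) = g * m := by
    rw [Nat.cast_mul, Nat.cast_sub hyz.le]
  rw [hgg]
  have h5 : g ^ 2 * (E.card - e) + ((g + 1) ^ 2 - g ^ 2) * (E.card - (α * E.card + e)) ≤
      g ^ 2 * (E.card - ((E.filter fun T => l1Dist (KMeansInstance.toReal (point A T)) (c (σ T)) <
      g * (m * θ)).card : ℝ)) + ((g + 1) ^ 2 - g ^ 2) * (E.card -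
      ((E.filter fun T => l1Dist (KMeansInstance.toReal (point A T)) (c (σ T)) <
      (g + 1) * (m * θ)).card : ℝ)) := by
    have h6 : 0 ≤ (g + 1) ^ 2 - g ^ 2 := by nlinarith
    gcongr
  refine le_trans (le_of_eq ?_) (mul_le_mul_of_nonneg_left h5 (sq_nonneg (m * θ)))
  rw [he]
  field_simp
  ring

end IsSetCode

/-- The `k`-means instance of a Johnson coverage instance. -/
def JCInstance.toKMeans (I : JCInstance) {d : ℕ} (A : Fin I.n → Finset (Fin d)) (r : ℕ) :
    KMeansInstance :=
  ⟨d, I.E.image (IsSetCode.point A), I.k, r⟩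

theorem JCInstance.exists_cost_le {I : JCInstance} {d m D z y : ℕ} {A : Fin I.n → Finset (Fin d)}
    (hA : IsSetCode I.E A m D) (hE : ∀ T ∈ I.E, T.card = z) (hk : 1 ≤ I.k)
    (h : I.Complete y) :
    ∃ c σ, (I.toKMeans A ((z - y) * m)).cost c σ ≤
      (((z - y) * m : ℕ) : ℝ) ^ 2 * (I.toKMeans A ((z - y) * m)).P.card := by
  obtain ⟨S, hS, hcov⟩ := h
  -- The condition is placed inside the existential so that choosing `j` gives an assignment defined
  -- on all bit vectors.
  have h1 : ∀ a : Fin d → Bool, ∃ j : Fin I.k, a ∈ I.E.image (IsSetCode.point A) →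
      l1Dist (KMeansInstance.toReal a) (KMeansInstance.toReal (IsSetCode.point A (S j))) ≤
        ((z - y) * m : ℕ) := by
    intro a
    by_cases ha : a ∈ I.E.image (IsSetCode.point A)
    · obtain ⟨T, hT, rfl⟩ := Finset.mem_image.1 ha
      have h2 := hT
      rw [← hcov] at h2
      obtain ⟨j, _, hj⟩ := Finset.mem_biUnion.1 h2
      refine ⟨j, fun _ => ?_⟩
      have := hA.l1Dist_le hE hT (Finset.mem_filter.1 hj).2
      rwa [hS] at this
    · exact ⟨⟨0, hk⟩, fun h => absurd h ha⟩
  choose σ hσ using h1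
  refine ⟨fun j => KMeansInstance.toReal (IsSetCode.point A (S j)), σ, ?_⟩
  have h2 := Finset.sum_le_card_nsmul (I.E.image (IsSetCode.point A)) _ _ fun a ha =>
    pow_le_pow_left₀ (l1Dist_nonneg _ _) (hσ a ha) 2
  rw [nsmul_eq_mul, mul_comm] at h2
  exact h2

/-- The loss in the approximation factor can be made arbitrarily small. -/
theorem exists_parameters (z : ℕ) (G ρ ε : ℝ) (hρ : 0 ≤ ρ) (hε : 0 < ε) : ∃ B D : ℕ, 0 < B ∧
    2 * z < D ∧ G - ε ≤ (1 - 2 * z / D : ℝ) ^ 2 * (G - ρ * (2 ^ z * z / B)) := by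
  obtain ⟨B, hB⟩ := exists_nat_gt (max 1 (2 * ρ * (2 ^ z * z) / ε))
  have hB0 : (0 : ℝ) < B := one_pos.trans ((le_max_left _ _).trans_lt hB)
  have hB1 : ρ * (2 ^ z * z / B) ≤ ε / 2 := by
    have h1 := ((le_max_right _ _).trans_lt hB).le
    rw [div_le_iff₀ hε] at h1
    rw [← mul_div_assoc, div_le_iff₀ hB0]
    linarith
  have hB2 : 0 ≤ ρ * (2 ^ z * z / B) := by positivity
  set X := G - ρ * (2 ^ z * z / B) with hX
  -- `D` is chosen after `B`, since it depends on `X`; the absolute value allows for a negative `X`.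
  obtain ⟨D, hD⟩ := exists_nat_gt (max (2 * z : ℝ) (8 * z * |X| / ε))
  have hD1 : (2 * z : ℝ) < D := (le_max_left _ _).trans_lt hD
  have hD0 : (0 : ℝ) < D := lt_of_le_of_lt (by positivity) hD1
  have hD2 : 4 * z / D * |X| ≤ ε / 2 := by
    have h1 := ((le_max_right _ _).trans_lt hD).le
    rw [div_le_iff₀ hε] at h1
    rw [div_mul_eq_mul_div, div_le_iff₀ hD0]
    linarith
  refine ⟨B, D, by exact_mod_cast hB0, by exact_mod_cast hD1, ?_⟩
  have ht : (0 : ℝ) ≤ 2 * z / D := by positivity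
  have ht1 : (2 * z : ℝ) / D < 1 := by rwa [div_lt_one hD0]
  have h4 : (4 * z : ℝ) / D = 2 * (2 * z / D) := by ring
  rw [h4] at hD2
  set t : ℝ := 2 * z / D
  have h5 : (2 * t - t ^ 2) * X ≤ 2 * t * |X| := by
    have := abs_nonneg X
    calc (2 * t - t ^ 2) * X ≤ (2 * t - t ^ 2) * |X| :=
          mul_le_mul_of_nonneg_left (le_abs_self X) (by nlinarith)
      _ ≤ 2 * t * |X| := by gcongr; nlinarith
  nlinarith

/-! ## Correctness of the reduction -/

theorem List.ofFn_getD_eq {w : List Bool} {d : ℕ} (h : w.length = d) :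
    List.ofFn (fun p : Fin d => w.getD p false) = w := by
  subst h
  refine List.ext_getElem (by simp) fun i h1 h2 => ?_
  simp

theorem count_true_ofFn {d : ℕ} (f : Fin d → Bool) :
    (List.ofFn f).count true = (Finset.univ.filter fun i => f i = true).card := by
  induction d with
  | zero => simp
  | succ d ih =>
    rw [List.ofFn_succ, List.count_cons, ih, Fin.card_filter_univ_succ]
    cases f 0 <;> simp

theorem mem_selected {T : List Bool} {code : List (List Bool)} {x : List Bool} :
    x ∈ ((T.zip code).filter fun p => p.1).map (fun p => p.2) ↔
      ∃ u : ℕ, T[u]? = some true ∧ code[u]? = some x := by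
  simp only [List.mem_map, List.mem_filter, Prod.exists]
  constructor
  · rintro ⟨a, b, ⟨h, h3⟩, rfl⟩
    obtain ⟨u, h⟩ := List.mem_iff_getElem?.1 h
    obtain ⟨h1, h2⟩ := List.getElem?_zip_eq_some.1 h
    exact ⟨u, by rw [h1]; exact congrArg some h3, h2⟩
  · rintro ⟨u, h1, h2⟩
    exact ⟨true, x, ⟨List.mem_iff_getElem?.2 ⟨u, List.getElem?_zip_eq_some.2 ⟨h1, h2⟩⟩, rfl⟩, rfl⟩

namespace JCInstance

variable (I : JCInstance) (l : List (Finset (Fin I.n)))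

/-- The bit vectors of a list of sets. -/
def rows : List (List Bool) := l.map fun T => List.ofFn fun i => decide (i ∈ T)

/-- The code words of the elements. -/
def codeSet (z D : ℕ) (u : Fin I.n) : Finset (Fin ((4 * z) ^ D * l.length.size)) :=
  Finset.univ.filter fun p =>
    ((coverCode D ((4 * z) ^ D) I.n (I.rows l)).getD u []).getD p false = true

variable {I l}

theorem length_rows : (I.rows l).length = l.length := by simp [rows]

theorem getElem?_used {T : Finset (Fin I.n)} (hT : T ∈ l) {u : Fin I.n} (hu : u ∈ T) :
    (orAll (List.replicate I.n false) (I.rows l))[(u : ℕ)]? = some true := by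
  have h1 : ∀ x ∈ I.rows l, x.length = (List.replicate I.n false).length := by
    intro x hx
    obtain ⟨T, _, rfl⟩ := List.mem_map.1 hx
    simp
  have h2 := (getD_orAll h1 u).2 (Or.inr ⟨_, List.mem_map_of_mem hT, by simp [hu]⟩)
  have h3 := length_orAll h1
  rw [List.length_replicate] at h3
  have h4 : (u : ℕ) < (orAll (List.replicate I.n false) (I.rows l)).length := by rw [h3]; exact u.2
  rw [List.getElem?_eq_getElem h4]
  simpa [List.getD_eq_getElem?_getD, List.getElem?_eq_getElem h4] using h2

/-- At most z|E| elements occur, and z|E| ≤ z·2^m ≤ (2z)^m. Counting only occurring elements lets m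
depend on |E| and not on n. -/
theorem count_used_le {z : ℕ} (hE : ∀ T ∈ l, T.card = z) (hl : l ≠ []) :
    (orAll (List.replicate I.n false) (I.rows l)).count true ≤ (2 * z) ^ l.length.size := by
  have h1 := count_orAll_le (w := List.replicate I.n false) (l := I.rows l) (z := z) ?_
  · rw [List.count_replicate, length_rows] at h1
    have h2 := Nat.lt_size_self l.length
    have h3 : 0 < l.length.size := Nat.size_pos.2 (List.length_pos_iff.2 hl)
    refine h1.trans ?_
    rw [mul_pow]
    simp only [beq_true, Bool.false_eq_true, if_false, zero_add]
    exact Nat.mul_le_mul h2.le (Nat.le_self_pow h3.ne' z)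
  · intro x hx
    obtain ⟨T, hT, rfl⟩ := List.mem_map.1 hx
    rw [count_true_ofFn, ← hE T hT]
    simp

theorem pool_large {z : ℕ} (D : ℕ) (hE : ∀ T ∈ l, T.card = z) (hl : l ≠ []) :
    (orAll (List.replicate I.n false) (I.rows l)).count true * ((4 * z) ^ D) ^ l.length.size ≤
      (2 * z) ^ l.length.size * (oneHotWords ((4 * z) ^ D) l.length.size).length := by
  rw [length_oneHotWords]
  exact Nat.mul_le_mul_right _ (count_used_le hE hl)

/-- The bridge between the computed lists and the finite sets of the geometric argument: an
occurring element gets a genuine pool word, and `codeSet` is its support. -/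
theorem exists_codeword {z : ℕ} (D : ℕ) (hz : 1 ≤ z) (hE : ∀ T ∈ l, T.card = z)
    {T : Finset (Fin I.n)} (hT : T ∈ l) {u : Fin I.n} (hu : u ∈ T) :
    ∃ w ∈ oneHotWords ((4 * z) ^ D) l.length.size,
      (coverCode D ((4 * z) ^ D) I.n (I.rows l))[(u : ℕ)]? = some w ∧
      w = List.ofFn fun p => decide (p ∈ I.codeSet l z D u) := by
  obtain ⟨w, hw, h⟩ := exists_getElem?_greedyCode hz (List.Sublist.refl _)
    (pool_large D hE (List.ne_nil_of_mem hT)) (getElem?_used hT hu)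
  have h' : (coverCode D ((4 * z) ^ D) I.n (I.rows l))[(u : ℕ)]? = some w := by
    rw [coverCode, length_rows]
    exact h
  refine ⟨w, hw, h', ?_⟩
  rw [← List.ofFn_getD_eq (length_of_mem_oneHotWords hw)]
  congr 1
  funext p
  rw [Bool.eq_iff_iff, decide_eq_true_iff, codeSet, Finset.mem_filter,
    List.getD_eq_getElem?_getD (l := coverCode _ _ _ _), h']
  simp

theorem isSetCode {z : ℕ} (D : ℕ) (hz : 1 ≤ z) (hE : ∀ T ∈ I.E, T.card = z)
    (hl : l.toFinset = I.E) : IsSetCode I.E (I.codeSet l z D) l.length.size D := by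
  have hmem : ∀ T, T ∈ I.E ↔ T ∈ l := fun T => by rw [← hl, List.mem_toFinset]
  have hE' : ∀ T ∈ l, T.card = z := fun T hT => hE T ((hmem T).2 hT)
  have hcommon : ∀ V V' : Finset (Fin ((4 * z) ^ D * l.length.size)), (V ∩ V').card =
      commonOnes (List.ofFn fun p => decide (p ∈ V)) (List.ofFn fun p => decide (p ∈ V')) := by
    intro V V'
    rw [commonOnes_ofFn]
    congr 1
    ext p
    simp
  constructor
  · intro T hT u hu
    obtain ⟨w, hw, _, hw'⟩ := exists_codeword D hz hE' ((hmem T).1 hT) hu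
    rw [← Finset.inter_self (I.codeSet l z D u), hcommon, ← hw', commonOnes_self_of_mem hw]
  -- The greedy guarantee is ordered, earlier word against later; symmetry of the intersection
  -- supplies the other case.
  · have key : ∀ T ∈ I.E, ∀ T' ∈ I.E, ∀ u ∈ T, ∀ v ∈ T', u < v →
        D * (I.codeSet l z D u ∩ I.codeSet l z D v).card ≤ l.length.size := by
      intro T hT T' hT' u hu v hv huv
      rw [hmem] at hT hT'
      obtain ⟨w, hw, h1, hw'⟩ := exists_codeword D hz hE' hT hu
      obtain ⟨x, hx, h2, hx'⟩ := exists_codeword D hz hE' hT' hv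
      rw [coverCode, length_rows] at h1 h2
      rw [hcommon, ← hw', ← hx']
      exact (commonOnes_lt_of_greedyCode hz (List.Sublist.refl _)
        (pool_large D hE' (List.ne_nil_of_mem hT)) huv (getElem?_used hT hu)
        (getElem?_used hT' hv) h1 h2).le
    intro T hT T' hT' u hu v hv huv
    rcases lt_or_gt_of_ne huv with h | h
    · exact key T hT T' hT' u hu v hv h
    · rw [Finset.inter_comm]
      exact key T' hT' T hT v hv u hu h

theorem embedSet_eq {z : ℕ} (D : ℕ) (hz : 1 ≤ z) (hE : ∀ T ∈ l, T.card = z)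
    {T : Finset (Fin I.n)} (hT : T ∈ l) :
    embedSet ((4 * z) ^ D * l.length.size) (coverCode D ((4 * z) ^ D) I.n (I.rows l))
      (List.ofFn fun i => decide (i ∈ T)) =
        List.ofFn (IsSetCode.point (I.codeSet l z D) T) := by
  have hget : ∀ u : ℕ, (List.ofFn fun i => decide (i ∈ T))[u]? = some true →
      ∃ i ∈ T, (i : ℕ) = u := by
    intro u hu
    obtain ⟨h1, h2⟩ := List.getElem?_eq_some_iff.1 hu
    rw [List.length_ofFn] at h1
    exact ⟨⟨u, h1⟩, by simpa using h2, rfl⟩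
  have hlen : ∀ x ∈ (((List.ofFn fun i => decide (i ∈ T)).zip (coverCode D ((4 * z) ^ D) I.n
      (I.rows l))).filter fun p => p.1).map (fun p => p.2),
      x.length = (List.replicate ((4 * z) ^ D * l.length.size) false).length := by
    intro x hx
    obtain ⟨u, h1, h2⟩ := mem_selected.1 hx
    obtain ⟨i, hi, rfl⟩ := hget u h1
    obtain ⟨w, hw, h3, _⟩ := exists_codeword D hz hE hT hi
    rw [h2] at h3
    obtain rfl := Option.some.inj h3
    simpa using length_of_mem_oneHotWords hw
  have h1 := length_orAll hlen
  rw [List.length_replicate] at h1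
  rw [embedSet, ← List.ofFn_getD_eq h1]
  congr 1
  funext p
  rw [Bool.eq_iff_iff, getD_orAll hlen, IsSetCode.point, bitsOfSet, decide_eq_true_iff,
    Finset.mem_biUnion]
  constructor
  · rintro (h | ⟨x, hx, h⟩)
    · simp at h
    · obtain ⟨u, h1, h2⟩ := mem_selected.1 hx
      obtain ⟨i, hi, rfl⟩ := hget u h1
      refine ⟨i, hi, Finset.mem_filter.2 ⟨Finset.mem_univ _, ?_⟩⟩
      rw [List.getD_eq_getElem?_getD (l := coverCode _ _ _ _), h2]
      exact h
  · rintro ⟨i, hi, h⟩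
    obtain ⟨w, hw, h3, hw'⟩ := exists_codeword D hz hE hT hi
    refine Or.inr ⟨w, mem_selected.2 ⟨i, by simp [hi], h3⟩, ?_⟩
    rw [hw']
    simp [h]

end JCInstance

/-- The reduction, on encodings. -/
theorem encode_kMeansReduction {I : JCInstance} {l : List (Finset (Fin I.n))} {z D : ℕ} (j : ℕ)
    (hz : 1 ≤ z) (hD : 2 * z < D) (hE : ∀ T ∈ I.E, T.card = z) (hnd : l.Nodup)
    (hl : l.toFinset = I.E) (hne : l ≠ []) :
    (I.toKMeans (I.codeSet l z D) (j * l.length.size)).Encodes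
      (encode (kMeansReduction D ((4 * z) ^ D) j (I.n, I.k, I.rows l))) := by
  have hmem : ∀ T, T ∈ I.E ↔ T ∈ l := fun T => by rw [← hl, List.mem_toFinset]
  have hm : 0 < l.length.size := Nat.size_pos.2 (List.length_pos_iff.2 hne)
  have hinj := (JCInstance.isSetCode D hz hE hl).point_injOn hD hE hm
  refine ⟨l.map (IsSetCode.point (I.codeSet l z D)), ?_, ?_, ?_⟩
  · exact List.Nodup.map_on (fun T hT T' hT' h => hinj ((hmem T).2 hT) ((hmem T').2 hT') h) hnd
  · have himage : (l.map (IsSetCode.point (I.codeSet l z D))).toFinset =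
        I.E.image (IsSetCode.point (I.codeSet l z D)) := by
      ext a
      simp [hmem]
    exact himage
  · have h1 : (I.rows l).map (embedSet ((4 * z) ^ D * l.length.size)
        (coverCode D ((4 * z) ^ D) I.n (I.rows l))) =
        l.map fun T => List.ofFn (IsSetCode.point (I.codeSet l z D) T) := by
      rw [JCInstance.rows, List.map_map]
      exact List.map_congr_left fun T hT =>
        JCInstance.embedSet_eq D hz (fun T hT => hE T ((hmem T).2 hT)) hT
    simp only [kMeansReduction, JCInstance.length_rows, h1]
    simp only [encode, List.map_map]
    rfl

/-! ### The hardness theorems -/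

theorem kMeans_hard_of_johnsonCoverage {α : ℝ} {z y : ℕ} (hy : 1 ≤ y) (hyz : y < z)
    (h : JohnsonCoverageStarNPHard α z y) {ε : ℝ} (hε : 0 < ε) :
    KMeansL1HardToApproximate
      (α + (1 - α) * (((z : ℝ) - y + 1) ^ 2 / ((z : ℝ) - y) ^ 2) - ε) := by
  obtain ⟨B, D, hB, hD, hfactor⟩ := exists_parameters z
    (α + (1 - α) * (((z : ℝ) - y + 1) ^ 2 / ((z : ℝ) - y) ^ 2))
    (((z : ℝ) - y + 1) ^ 2 / ((z : ℝ) - y) ^ 2) ε (by positivity) hε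
  have hz : 1 ≤ z := by omega
  let N := (4 * z) ^ D
  have hlog2 : 0 < Real.log 2 := Real.log_pos (by norm_num)
  refine ⟨N * (2 / Real.log 2), fun L hL => ?_⟩
  obtain ⟨f, hf, hfL⟩ := h B L hL
  -- Every `f w` encodes a valid dense instance, whether w is in L or not, so malformed inputs never
  -- arise. The list `l` records the order in which the encoding presents `E`.
  have hdec : ∀ w, ∃ I : JCInstance, ∃ l : List (Finset (Fin I.n)), l.Nodup ∧ l.toFinset = I.E ∧
      f w = encode (I.n, I.k, I.rows l) ∧ I.Valid z ∧ I.Dense z y B ∧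
      (w ∈ L → I.Complete y) ∧ (w ∉ L → I.Sound α y) := by
    intro w
    have henc : ∀ (I : JCInstance) (l : List (Finset (Fin I.n))),
        BTree.cons (BTree.ofNat I.n) (BTree.cons (BTree.ofNat I.k)
          (BTree.ofList (l.map JCInstance.treeOfSet))) = encode (I.n, I.k, I.rows l) := by
      intro I l
      simp only [encode, JCInstance.rows, List.map_map]
      rfl
    by_cases hw : w ∈ L
    · obtain ⟨I, ⟨l, h1, h2, h3⟩, h4, h5, h6⟩ := (hfL w).1 hw
      exact ⟨I, l, h1, h2, h3.trans (henc I l), h4, h5, fun _ => h6, fun h => absurd hw h⟩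
    · obtain ⟨I, ⟨l, h1, h2, h3⟩, h4, h5, h6⟩ := (hfL w).2 hw
      exact ⟨I, l, h1, h2, h3.trans (henc I l), h4, h5, fun h => absurd h hw, fun _ => h6⟩
  choose I l hnd hl hfw hvalid hdense hyes hno using hdec
  have hx : PolyComp fun w : List Bool => ((I w).n, (I w).k, (I w).rows (l w)) := by
    obtain ⟨p, T, hp⟩ := hf
    exact ⟨p, T, fun w => by beta_reduce; rw [← hfw]; exact hp w⟩
  have hmem : ∀ w T, T ∈ (I w).E ↔ T ∈ l w := fun w T => by rw [← hl, List.mem_toFinset]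
  have hne : ∀ w, l w ≠ [] := fun w h => by
    obtain ⟨T, hT⟩ := (hvalid w).1
    rw [hmem, h] at hT
    simp at hT
  have hcode := fun w => JCInstance.isSetCode D hz (hvalid w).2.1 (hl w)
  have hm : ∀ w, 0 < (l w).length.size := fun w => Nat.size_pos.2 (List.length_pos_iff.2 (hne w))
  have hinj := fun w => (hcode w).point_injOn hD (hvalid w).2.1 (hm w)
  let J : List Bool → KMeansInstance := fun w =>
    (I w).toKMeans ((I w).codeSet (l w) z D) ((z - y) * (l w).length.size)
  have hcard : ∀ w, (J w).P.card = (I w).E.card := fun w => Finset.card_image_of_injOn (hinj w)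
  have hcardl : ∀ w, (I w).E.card = (l w).length := fun w => by
    rw [← hl, List.toFinset_card_of_nodup (hnd w)]
  have hJvalid : ∀ w, (J w).Valid := fun w =>
    ⟨(hvalid w).1.image _, (hvalid w).2.2, Nat.mul_pos (by omega) (hm w)⟩
  have hdim : ∀ w, ((J w).d : ℝ) ≤ N * (2 / Real.log 2) * Real.log ((J w).P.card + 1) := by
    intro w
    rw [hcard, hcardl]
    change ((N * (l w).length.size : ℕ) : ℝ) ≤ _
    rw [Nat.cast_mul, mul_assoc]
    refine mul_le_mul_of_nonneg_left ?_ (Nat.cast_nonneg _)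
    have h1 := two_pow_size_le (l w).length
    -- From 2^m ≤ 2|E| + 1 ≤ (|E| + 1)² one gets m ≤ (2/log 2)·log(|E| + 1), the origin of the
    -- constant K.
    have h2 : (2 : ℝ) ^ (l w).length.size ≤ ((l w).length + 1) ^ 2 := by
      have h3 : 2 ^ (l w).length.size ≤ ((l w).length + 1) ^ 2 := h1.trans (by nlinarith)
      exact_mod_cast h3
    have h3 := Real.log_le_log (by positivity) h2
    rw [Real.log_pow, Real.log_pow] at h3
    rw [div_mul_eq_mul_div, le_div_iff₀ hlog2]
    exact_mod_cast h3
  refine ⟨fun w => encode (kMeansReduction D N (z - y) ((I w).n, (I w).k, (I w).rows (l w))),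
    (PolyComp.kMeansReduction D N (z - y)).comp hx, fun w => ⟨fun hw => ?_, fun hw => ?_⟩⟩
  · exact ⟨J w, encode_kMeansReduction (z - y) hz hD (hvalid w).2.1 (hnd w) (hl w) (hne w),
      hJvalid w, hdim w, JCInstance.exists_cost_le (hcode w) (hvalid w).2.1 (hvalid w).2.2
        (hyes w hw)⟩
  · refine ⟨J w, encode_kMeansReduction (z - y) hz hD (hvalid w).2.1 (hnd w) (hl w) (hne w),
      hJvalid w, hdim w, fun c σ => ?_⟩
    have h1 := (hcode w).le_sum_sq hD (hvalid w).2.1 (hm w) hy hyz (hvalid w).1 hB (hdense w)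
      (hno w hw) c fun T => σ (IsSetCode.point ((I w).codeSet (l w) z D) T)
    have h2 : (J w).cost c σ = ∑ T ∈ (I w).E, l1Dist (KMeansInstance.toReal
        (IsSetCode.point ((I w).codeSet (l w) z D) T))
        (c (σ (IsSetCode.point ((I w).codeSet (l w) z D) T))) ^ 2 :=
      Finset.sum_image (hinj w)
    rw [h2, hcard]
    exact (mul_le_mul_of_nonneg_right hfactor (by positivity)).trans h1

theorem KMeansL1HardToApproximate.mono {F G : ℝ} (h : KMeansL1HardToApproximate G) (hFG : F ≤ G) :
    KMeansL1HardToApproximate F := by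
  obtain ⟨K, hK⟩ := h
  refine ⟨K, fun L hL => ?_⟩
  obtain ⟨f, hf, hfL⟩ := hK L hL
  refine ⟨f, hf, fun w => ⟨(hfL w).1, fun hw => ?_⟩⟩
  obtain ⟨I, h1, h2, h3, h4⟩ := (hfL w).2 hw
  exact ⟨I, h1, h2, h3, fun c σ => (mul_le_mul_of_nonneg_right hFG (by positivity)).trans (h4 c σ)⟩

theorem kMeans_hard_of_JCHStar (h : JCHStar) {ε : ℝ} (hε : 0 < ε) :
    KMeansL1HardToApproximate (1 + 3 / Real.exp 1 - ε) := by
  -- With z - y = 1 the factor is 1 + 3(1-α), so ε/6 in α costs ε/2; the other ε/2 is lost in the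
  -- reduction.
  obtain ⟨z, hz, hJ⟩ := h (ε / 6) (by positivity)
  refine (kMeans_hard_of_johnsonCoverage (by omega) (by omega) hJ (half_pos hε)).mono
    (le_of_eq ?_)
  rw [Nat.cast_sub (by omega), Nat.cast_one, sub_sub_cancel]
  ring

theorem mainTheorem9 :
    (∀ (α : ℝ) (z y : ℕ), 1 ≤ y → y < z → JohnsonCoverageStarNPHard α z y →
      ∀ ε : ℝ, 0 < ε → KMeansL1HardToApproximate
        (α + (1 - α) * (((z : ℝ) - y + 1) ^ 2 / ((z : ℝ) - y) ^ 2) - ε)) ∧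
    (JCHStar →
      (∀ ε : ℝ, 0 < ε → KMeansL1HardToApproximate (1 + 3 / Real.exp 1 - ε)) ∧
      KMeansL1HardToApproximate 2.10) := by
  refine ⟨fun α z y hy hyz h ε hε => kMeans_hard_of_johnsonCoverage hy hyz h hε,
    fun h => ⟨fun ε hε => kMeans_hard_of_JCHStar h hε, ?_⟩⟩
  -- Since 3/e exceeds 1.103, there is room for this ε: it suffices that 3/e ≥ 1.101.
  refine (kMeans_hard_of_JCHStar h (ε := 0.001) (by norm_num)).mono ?_
  have h1 := Real.exp_one_lt_d9
  have h2 : 1.101 ≤ 3 / Real.exp 1 := by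
    rw [le_div_iff₀ (Real.exp_pos 1)]
    linarith
  linarith
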